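/- Let $n\ge 1$, $s\in(0,\tfrac12)$, let $\gamma:\mathbb R^{n-1}\to\mathbb R$ be a function, and let $E=\{x=(x',x_n)\in\mathbb R^n : x_n<\gamma(x')\}$ be the corresponding epigraph (with the convention that $E$ lies below the graph). Suppose that $\partial E$ is of class $C^2$ everywhere, that is, every $p\in\partial E$ has a neighbourhood $U$ and a $C^2$ function $f:U\to\mathbb R$ with $f(p)=0$, $\nabla f(p)\ne 0$, such that $\{f<0\}\subseteq E$ and $\{f>0\}\subseteq \mathbb R^n\setminus E$; the exterior normal of $E$ at $p$ is then $\nu(p)=\nabla f(p)/|\nabla f(p)|$. (The function $\gamma$ itself is not assumed to be differentiable.) Suppose moreover that the nonlocal mean curvature of $E$ vanishes at every boundary point, that is, $$H^s_E(p):=\lim_{\rho\searrow0}\int_{\mathbb R^n\setminus B_\rho(p)}\frac{\chi_{E^c}(x)-\chi_E(x)}{|x-p|^{n+2s}}\,dx=0\qquad\text{for every }p\in\partial E .$$ Then the exterior normal $\nu=(\nu_1,\dots,\nu_n)$ of $E$ is never horizontal: $\nu_n(x)\neq0$ for every $x\in\partial E$. -/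

import Mathlib

open Set Filter Topology MeasureTheory

noncomputable section

/-- The first `n` coordinates `x'` of a point `x = (x', x_{n+1})` of `ℝ^{n+1}`. -/
def horizontalPart {n : ℕ} (x : EuclideanSpace ℝ (Fin (n + 1))) : EuclideanSpace ℝ (Fin n) :=
  WithLp.toLp 2 (fun i : Fin n => x i.castSucc)

/-- The "epigraph" `{x | x_{n+1} < γ(x')} ⊆ ℝ^{n+1}` of `γ : ℝ^n → ℝ`. The convention is that
the set lies below the graph, so that its exterior normal points upwards. -/
def graphRegion {n : ℕ} (γ : EuclideanSpace ℝ (Fin n) → ℝ) :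
    Set (EuclideanSpace ℝ (Fin (n + 1))) :=
  {x | x (Fin.last n) < γ (horizontalPart x)}

/-- `f` is a `C²` defining function of the set `E` near the point `p`: it is of class `C²` near
`p`, it vanishes at `p` with nonzero gradient, and near `p` the set `E` is `{f < 0}`, up to points
of the hypersurface `{f = 0}` (which is then `∂E` near `p`). -/
structure IsC2DefiningFunction {d : ℕ} (E : Set (EuclideanSpace ℝ (Fin d)))
    (p : EuclideanSpace ℝ (Fin d)) (f : EuclideanSpace ℝ (Fin d) → ℝ) : Prop where
  contDiffAt : ContDiffAt ℝ 2 f p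
  eq_zero : f p = 0
  gradient_ne_zero : gradient f p ≠ 0
  mem_of_neg : ∀ᶠ x in 𝓝 p, f x < 0 → x ∈ E
  notMem_of_pos : ∀ᶠ x in 𝓝 p, 0 < f x → x ∉ E

/-- The whole boundary of `E` is of class `C²`. -/
def HasC2Boundary {d : ℕ} (E : Set (EuclideanSpace ℝ (Fin d))) : Prop :=
  ∀ p ∈ frontier E, ∃ f, IsC2DefiningFunction E p f

/-- `ν` is the exterior unit normal of `E` at `p`. -/
def IsExteriorNormal {d : ℕ} (E : Set (EuclideanSpace ℝ (Fin d)))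
    (p ν : EuclideanSpace ℝ (Fin d)) : Prop :=
  ∃ f, IsC2DefiningFunction E p f ∧ ν = ‖gradient f p‖⁻¹ • gradient f p

/-- The integral of `(χ_{Eᶜ}(x) - χ_E(x)) / |x - p|^{d + 2s}` over the complement of the ball of
radius `ρ` centred at `p`, in `ℝ^d`. -/
def truncatedMeanCurvature {d : ℕ} (s : ℝ) (E : Set (EuclideanSpace ℝ (Fin d)))
    (p : EuclideanSpace ℝ (Fin d)) (ρ : ℝ) : ℝ :=
  ∫ x in (Metric.ball p ρ)ᶜ,
    (Eᶜ.indicator (fun _ => (1 : ℝ)) x - E.indicator (fun _ => (1 : ℝ)) x)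
      / ‖x - p‖ ^ ((d : ℝ) + 2 * s)

/-- The nonlocal mean curvature of `E` at `p`, with fractional parameter `s`, exists in the
principal value sense and equals `H`. -/
def HasNonlocalMeanCurvature {d : ℕ} (s : ℝ) (E : Set (EuclideanSpace ℝ (Fin d)))
    (p : EuclideanSpace ℝ (Fin d)) (H : ℝ) : Prop :=
  Tendsto (truncatedMeanCurvature s E p) (𝓝[>] 0) (𝓝 H)

/-- A set with `C²` boundary has an exterior normal at every boundary point. -/
theorem HasC2Boundary.exists_isExteriorNormal {d : ℕ} {E : Set (EuclideanSpace ℝ (Fin d))}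
    (hE : HasC2Boundary E) {p : EuclideanSpace ℝ (Fin d)} (hp : p ∈ frontier E) :
    ∃ ν, IsExteriorNormal E p ν :=
  let ⟨f, hf⟩ := hE p hp
  ⟨_, f, hf, rfl⟩

end

/-! Suppose the normal at `p` is horizontal. Then the vertical unit vector `e` is tangent to `∂E` at
`p`, while `E - t e ⊆ E` for `t ≥ 0` because `E` is a subgraph. The volume of `E \ (E - t e)` in a
fixed ball is then estimated in two incompatible ways.

Linear lower bound (`exists_le_volume_diff`): `E` has positive volume and no point stays in `E` when
moved up indefinitely, so for some `S` a piece of `E` of positive volume has left `E` after a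
translation by `S e`. Cutting this translation into `L` steps shows that the step `t = S / L` loses
a volume of order at least `t`.

Quadratic upper bound (`IsLocalChart.exists_volume_diff_le`): by tangency and the `C²` bound, `f (p
+ t e) = O(t²)`, so the boundary of `E - t e` passes at distance `O(t²)` from `p`. Shifting `E - t
e` by `O(t²)` and bending it by a paraboloid of opening `O(t²)` makes it touch `E` from inside at a
point `P = Q + τ v` of `∂E`, coming from `q = Q + t e`, also in `∂E`
(`IsLocalChart.exists_touching`). The nonlocal mean curvature vanishes at both `P` and `q`.
Symmetrizing in `z ↔ -z` turns the principal values into absolutely convergent integrals, uniformly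
bounded near `p` (`IsLocalChart.exists_lintegral_symmIndicator_le`), and the kernel is split into a
near and a far part.

In the near part, a shear of determinant one absorbs the linear part of the paraboloid. What remains
is a layer of thickness `O(t² |y|²)` over the transversal coordinates `y ∈ ℝ^n`; its integral
against `|z|^(-a)`, `a = n + 1 + 2s`, is `O(t²)` exactly because `a < n + 2`, that is, `s < 1/2`. In
the far part the base point moves by `O(t²)`, and the inclusion `E - t e ⊆ E` contributes a gain at
least proportional to the lost volume. As everything sums to zero, this volume is `O(t²)`, against
the linear lower bound when `L → ∞`. The curvature equation is never differentiated, so `C²`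
regularity suffices. -/

open scoped ENNReal NNReal

noncomputable section

/-! ### Slicing along a coordinate axis -/

/-- The coordinates of `z` other than the `i`-th one. -/
def dropCoord {n : ℕ} (i : Fin (n + 1)) (z : EuclideanSpace ℝ (Fin (n + 1))) : Fin n → ℝ :=
  fun j => z (i.succAbove j)

theorem dropCoord_add {n : ℕ} (i : Fin (n + 1)) (x y : EuclideanSpace ℝ (Fin (n + 1))) :
    dropCoord i (x + y) = dropCoord i x + dropCoord i y := rfl

theorem dropCoord_smul {n : ℕ} (i : Fin (n + 1)) (c : ℝ) (x : EuclideanSpace ℝ (Fin (n + 1))) :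
    dropCoord i (c • x) = c • dropCoord i x := rfl

theorem norm_dropCoord_le {n : ℕ} (i : Fin (n + 1)) (z : EuclideanSpace ℝ (Fin (n + 1))) :
    ‖dropCoord i z‖ ≤ ‖z‖ :=
  (pi_norm_le_iff_of_nonneg (norm_nonneg _)).2 fun j => PiLp.norm_apply_le z (i.succAbove j)

theorem eq_add_smul_single_of_dropCoord_eq {n : ℕ} {i : Fin (n + 1)}
    {x y : EuclideanSpace ℝ (Fin (n + 1))} (h : dropCoord i x = dropCoord i y) :
    x = y + (x i - y i) • EuclideanSpace.single i (1 : ℝ) := by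
  ext j
  rcases Fin.eq_self_or_eq_succAbove i j with rfl | ⟨k, rfl⟩
  · simp
  · have := congrFun h k
    simp only [dropCoord] at this
    simp [this, Fin.succAbove_ne]

/-- The splitting of `ℝ^{n+1}` into the `i`-th coordinate and the others preserves volume. -/
theorem measurePreserving_splitCoord {n : ℕ} (i : Fin (n + 1)) :
    MeasurePreserving (fun z : EuclideanSpace ℝ (Fin (n + 1)) => (z i, dropCoord i z)) :=
  (volume_preserving_piFinSuccAbove (fun _ : Fin (n + 1) => ℝ) i).comp
    (PiLp.volume_preserving_ofLp (Fin (n + 1)))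

theorem measurableEmbedding_splitCoord {n : ℕ} (i : Fin (n + 1)) :
    MeasurableEmbedding (fun z : EuclideanSpace ℝ (Fin (n + 1)) => (z i, dropCoord i z)) :=
  ((MeasurableEquiv.toLp 2 (Fin (n + 1) → ℝ)).symm.trans
    (MeasurableEquiv.piFinSuccAbove (fun _ : Fin (n + 1) => ℝ) i)).measurableEmbedding

/-- Integration over a set whose sections in the `i`-th direction have controlled diameter. -/
theorem setLIntegral_le_of_section_diam_le {n : ℕ} (i : Fin (n + 1))
    {A : Set (EuclideanSpace ℝ (Fin (n + 1)))} (hA : MeasurableSet A) (w : (Fin n → ℝ) → ℝ)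
    (hw : ∀ z₁ ∈ A, ∀ z₂ ∈ A, dropCoord i z₁ = dropCoord i z₂ →
      |z₁ i - z₂ i| ≤ w (dropCoord i z₁))
    (g : (Fin n → ℝ) → ℝ≥0∞) (hg : Measurable g) :
    ∫⁻ z in A, g (dropCoord i z) ≤ ∫⁻ y, ENNReal.ofReal (w y) * g y := by
  set Ψ := fun z : EuclideanSpace ℝ (Fin (n + 1)) => (z i, dropCoord i z) with hΨ
  have hemb := measurableEmbedding_splitCoord i
  have hmp := measurePreserving_splitCoord i
  have hA' : MeasurableSet (Ψ '' A) := hemb.measurableSet_image' hA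
  have hpre : Ψ ⁻¹' (Ψ '' A) = A := preimage_image_eq _ hemb.injective
  calc ∫⁻ z in A, g (dropCoord i z)
      = ∫⁻ z, (Ψ '' A).indicator (fun q => g q.2) (Ψ z) := by
        rw [← lintegral_indicator hA]
        congr 1 with z
        by_cases hz : z ∈ A
        · rw [indicator_of_mem hz, indicator_of_mem (mem_image_of_mem _ hz)]
        · rw [indicator_of_notMem hz, indicator_of_notMem]
          rwa [hemb.injective.mem_set_image]
    _ = ∫⁻ q : ℝ × (Fin n → ℝ), (Ψ '' A).indicator (fun q => g q.2) q :=
        hmp.lintegral_comp_emb hemb _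
    _ = ∫⁻ y : Fin n → ℝ, ∫⁻ τ : ℝ, (Ψ '' A).indicator (fun q => g q.2) (τ, y) := by
        rw [Measure.volume_eq_prod]
        exact lintegral_prod_symm' _ ((hg.comp measurable_snd).indicator hA')
    _ ≤ ∫⁻ y, ENNReal.ofReal (w y) * g y := by
        refine lintegral_mono fun y => ?_
        have hmeas : MeasurableSet ((fun τ : ℝ => (τ, y)) ⁻¹' (Ψ '' A)) :=
          hA'.preimage measurable_prodMk_right
        have : ∀ τ : ℝ, (Ψ '' A).indicator (fun q => g q.2) (τ, y) =
            ((fun τ : ℝ => (τ, y)) ⁻¹' (Ψ '' A)).indicator (fun _ => g y) τ := fun τ => rfl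
        simp_rw [this]
        rw [lintegral_indicator_const hmeas, mul_comm]
        gcongr
        -- Lebesgue measure on the line is at most the diameter, so nothing needs to be known about
        -- the shape of the sections.
        refine (Real.volume_le_diam _).trans (Metric.ediam_le ?_)
        rintro τ₁ ⟨z₁, hz₁, h₁⟩ τ₂ ⟨z₂, hz₂, h₂⟩
        simp only [hΨ, Prod.mk.injEq] at h₁ h₂
        have := hw z₁ hz₁ z₂ hz₂ (h₁.2.trans h₂.2.symm)
        rw [h₁.1, h₂.1, h₁.2] at this
        rw [edist_dist, Real.dist_eq]
        exact ENNReal.ofReal_le_ofReal this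

/-! ### Kernel integrals over thin layers -/

/-- In polar coordinates the radial integrand is `ρ ^ (b + n - 1)`, whose exponent exceeds `-1`. -/
theorem lintegral_ball_norm_rpow_lt_top {n : ℕ} {b : ℝ} (hn : 0 < n) (hb : -(n : ℝ) < b) (r : ℝ) :
    ∫⁻ y in Metric.ball (0 : Fin n → ℝ) r, ENNReal.ofReal (‖y‖ ^ b) < ∞ := by
  have : Nonempty (Fin n) := ⟨⟨0, hn⟩⟩
  have h : IntegrableOn (fun y : Fin n → ℝ => (fun ρ : ℝ => ρ ^ b) ‖y‖)
      (Metric.ball (0 : Fin n → ℝ) r) := by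
    refine (integrableOn_fun_norm_addHaar volume (f := fun ρ : ℝ => ρ ^ b)).2 ?_
    rcases le_or_gt r 0 with hr | hr
    · simp [Ioo_eq_empty (not_lt.2 hr)]
    have h1 : IntervalIntegrable (fun ρ : ℝ => ρ ^ (b + (n - 1 : ℝ))) volume 0 r :=
      intervalIntegral.intervalIntegrable_rpow' (by linarith)
    rw [intervalIntegrable_iff_integrableOn_Ioo_of_le hr.le] at h1
    refine h1.congr_fun (fun ρ hρ => ?_) measurableSet_Ioo
    have h2 : ρ ^ (n - 1) = ρ ^ ((n : ℝ) - 1) := by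
      rw [← Real.rpow_natCast, Nat.cast_sub hn, Nat.cast_one]
    simp only [Module.finrank_fin_fun, smul_eq_mul, h2]
    rw [← Real.rpow_add hρ.1, add_comm]
  refine lt_of_le_of_lt (lintegral_mono fun y => ?_) h.2
  rw [← ofReal_norm]
  exact ENNReal.ofReal_le_ofReal (Real.norm_of_nonneg (by positivity)).ge

/-- A layer around a hypersurface through the origin, whose thickness in the `i`-th direction is
quadratically small at the origin, carries a finite integral of the kernel `|z|^{-a}`,
`a < n + 2`. -/
theorem exists_setLIntegral_kernel_layer_le {n : ℕ} {a : ℝ} (hn : 0 < n) (ha0 : 0 < a)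
    (ha : a < n + 2) (r : ℝ) :
    ∃ C : ℝ, 0 ≤ C ∧ ∀ (i : Fin (n + 1)) (A : Set (EuclideanSpace ℝ (Fin (n + 1)))) (w : ℝ),
      MeasurableSet A → A ⊆ Metric.closedBall 0 r → 0 ≤ w →
      (∀ z₁ ∈ A, ∀ z₂ ∈ A, dropCoord i z₁ = dropCoord i z₂ →
        |z₁ i - z₂ i| ≤ w * ‖dropCoord i z₁‖ ^ 2) →
      ∫⁻ z in A, ENNReal.ofReal (‖z‖ ^ (-a)) ≤ ENNReal.ofReal (w * C) := by
  set B := Metric.ball (0 : Fin n → ℝ) (r + 1)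
  have hfin := lintegral_ball_norm_rpow_lt_top hn (show -(n : ℝ) < 2 - a by linarith) (r + 1)
  refine ⟨(∫⁻ y in B, ENNReal.ofReal (‖y‖ ^ (2 - a))).toReal, ENNReal.toReal_nonneg,
    fun i A w hA hAr hw hsec => ?_⟩
  -- The power is taken in `ℝ≥0∞`, so `g` is `∞` at the origin and dominates the kernel even on the
  -- axis `dropCoord i z = 0`. The quadratic weight vanishes there, and `0 * ∞ = 0`.
  set g : (Fin n → ℝ) → ℝ≥0∞ := B.indicator fun y => ‖y‖ₑ ^ (-a)
  have hg : Measurable g := by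
    refine Measurable.indicator ?_ Metric.isOpen_ball.measurableSet
    fun_prop
  calc ∫⁻ z in A, ENNReal.ofReal (‖z‖ ^ (-a))
      ≤ ∫⁻ z in A, g (dropCoord i z) := by
        refine setLIntegral_mono' hA fun z hz => ?_
        have hzr : ‖z‖ ≤ r := by simpa using hAr hz
        have hzB : dropCoord i z ∈ B := by
          have := norm_dropCoord_le i z
          simp only [B, Metric.mem_ball, dist_zero_right]
          linarith
        simp only [g, indicator_of_mem hzB]
        rw [ENNReal.rpow_neg]
        rcases eq_or_ne z 0 with rfl | hz0
        · simp [Real.zero_rpow (neg_ne_zero.2 ha0.ne')]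
        · have hzpos : 0 < ‖z‖ := norm_pos_iff.2 hz0
          rw [Real.rpow_neg hzpos.le, ENNReal.ofReal_inv_of_pos (Real.rpow_pos_of_pos hzpos _),
            ← ENNReal.ofReal_rpow_of_pos hzpos, ofReal_norm]
          gcongr
          rw [← ofReal_norm, ← ofReal_norm]
          exact ENNReal.ofReal_le_ofReal (norm_dropCoord_le i z)
    _ ≤ ∫⁻ y, ENNReal.ofReal (w * ‖y‖ ^ 2) * g y :=
        setLIntegral_le_of_section_diam_le i hA (fun y => w * ‖y‖ ^ 2) hsec g hg
    _ ≤ ∫⁻ y, ENNReal.ofReal w * B.indicator (fun y => ENNReal.ofReal (‖y‖ ^ (2 - a))) y := by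
        refine lintegral_mono fun y => ?_
        by_cases hy : y ∈ B
        · simp only [g, indicator_of_mem hy]
          rcases eq_or_ne y 0 with rfl | hy0
          · simp
          · have hypos : 0 < ‖y‖ := norm_pos_iff.2 hy0
            rw [ENNReal.ofReal_mul hw, mul_assoc, ← ofReal_norm,
              ENNReal.ofReal_rpow_of_pos hypos, ← ENNReal.ofReal_mul (by positivity),
              sub_eq_add_neg, Real.rpow_add hypos]
            simp
        · simp [g, indicator_of_notMem hy]
    _ = ENNReal.ofReal (w * (∫⁻ y in B, ENNReal.ofReal (‖y‖ ^ (2 - a))).toReal) := by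
        rw [lintegral_const_mul' _ _ ENNReal.ofReal_ne_top,
          lintegral_indicator Metric.isOpen_ball.measurableSet, ENNReal.ofReal_mul hw,
          ENNReal.ofReal_toReal hfin.ne]

/-! ### Local charts of the boundary -/

/-- Quantitative information on a defining function `f` of `E` on the closed ball of radius `R`
centred at `p`: a second order Taylor bound with gradient `G`, and strict monotonicity in the
direction `v`. -/
structure IsLocalChart {W : Type*} [NormedAddCommGroup W] [NormedSpace ℝ W] (E : Set W) (p v : W)
    (f : W → ℝ) (G : W → W →L[ℝ] ℝ) (R c C : ℝ) : Prop where
  R_pos : 0 < R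
  c_pos : 0 < c
  C_pos : 0 < C
  continuousOn : ContinuousOn f (Metric.closedBall p R)
  norm_le : ∀ x ∈ Metric.closedBall p R, ‖G x‖ ≤ C
  le_apply : ∀ x ∈ Metric.closedBall p R, c ≤ G x v
  taylor : ∀ x ∈ Metric.closedBall p R, ∀ y ∈ Metric.closedBall p R,
    |f y - f x - G x (y - x)| ≤ C * ‖y - x‖ ^ 2
  mono : ∀ x ∈ Metric.closedBall p R, ∀ δ : ℝ, 0 ≤ δ → x + δ • v ∈ Metric.closedBall p R →
    f x + c * δ ≤ f (x + δ • v)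
  mem_of_neg : ∀ x ∈ Metric.closedBall p R, f x < 0 → x ∈ E
  notMem_of_pos : ∀ x ∈ Metric.closedBall p R, 0 < f x → x ∉ E

namespace IsLocalChart

variable {W : Type*} [NormedAddCommGroup W] [NormedSpace ℝ W] {E : Set W} {p v : W}
  {f : W → ℝ} {G : W → W →L[ℝ] ℝ} {R c C : ℝ}

/-- The zero set of the defining function consists of boundary points. -/
theorem mem_frontier (h : IsLocalChart E p v f G R c C) {x : W} (hx : x ∈ Metric.ball p R)
    (h0 : f x = 0) : x ∈ frontier E := by
  have hlim : Tendsto (fun δ : ℝ => x + δ • v) (𝓝[>] 0) (𝓝 x) := by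
    have : Tendsto (fun δ : ℝ => x + δ • v) (𝓝 0) (𝓝 (x + (0 : ℝ) • v)) :=
      Continuous.tendsto (by fun_prop) 0
    rw [zero_smul, add_zero] at this
    exact this.mono_left nhdsWithin_le_nhds
  have hlim' : Tendsto (fun δ : ℝ => x - δ • v) (𝓝[>] 0) (𝓝 x) := by
    have : Tendsto (fun δ : ℝ => x - δ • v) (𝓝 0) (𝓝 (x - (0 : ℝ) • v)) :=
      Continuous.tendsto (by fun_prop) 0
    rw [zero_smul, sub_zero] at this
    exact this.mono_left nhdsWithin_le_nhds
  have hb := Metric.isOpen_ball.mem_nhds hx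
  have hsub : Metric.ball p R ⊆ Metric.closedBall p R := Metric.ball_subset_closedBall
  rw [frontier_eq_closure_inter_closure]
  constructor
  · refine mem_closure_of_tendsto hlim' ?_
    filter_upwards [hlim' hb, self_mem_nhdsWithin] with δ hδ (hpos : 0 < δ)
    refine h.mem_of_neg _ (hsub hδ) ?_
    have := h.mono _ (hsub hδ) δ hpos.le (by simpa using hsub hx)
    rw [sub_add_cancel, h0] at this
    nlinarith [mul_pos h.c_pos hpos]
  · refine mem_closure_of_tendsto hlim ?_
    filter_upwards [hlim hb, self_mem_nhdsWithin] with δ hδ (hpos : 0 < δ)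
    refine h.notMem_of_pos _ (hsub hδ) ?_
    have := h.mono _ (hsub hx) δ hpos.le (hsub hδ)
    rw [h0] at this
    nlinarith [mul_pos h.c_pos hpos]

/-- A set with a local chart has interior points. -/
theorem nonempty_interior (h : IsLocalChart E p v f G R c C) (h0 : f p = 0) :
    (interior E).Nonempty := by
  have hlim : Tendsto (fun δ : ℝ => p - δ • v) (𝓝 0) (𝓝 (p - (0 : ℝ) • v)) :=
    Continuous.tendsto (by fun_prop) 0
  rw [zero_smul, sub_zero] at hlim
  obtain ⟨δ, hδ, (hpos : 0 < δ)⟩ := (((hlim.mono_left nhdsWithin_le_nhds).eventually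
    (Metric.isOpen_ball.mem_nhds (Metric.mem_ball_self h.R_pos))).and
      (self_mem_nhdsWithin (s := Ioi (0 : ℝ)))).exists
  have hsub : Metric.ball p R ⊆ Metric.closedBall p R := Metric.ball_subset_closedBall
  have h1 := h.mono _ (hsub hδ) δ hpos.le (by simpa using h.R_pos.le)
  rw [sub_add_cancel, h0] at h1
  have hneg : f (p - δ • v) < 0 := by nlinarith [mul_pos h.c_pos hpos]
  have hb := Metric.isOpen_ball.mem_nhds hδ
  have hcont : ContinuousAt f (p - δ • v) :=
    h.continuousOn.continuousAt (Filter.mem_of_superset hb hsub)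
  refine ⟨p - δ • v, mem_interior_iff_mem_nhds.2 ?_⟩
  filter_upwards [hb, hcont.eventually_lt continuousAt_const hneg] with y hy hy'
  exact h.mem_of_neg y (hsub hy) hy'

/-- A strict sign of `f` persists nearby, which would put `x` in the interior of `E` or of its
complement. -/
theorem eq_zero_of_mem_frontier (h : IsLocalChart E p v f G R c C) {x : W}
    (hx : x ∈ Metric.ball p R) (hE : x ∈ frontier E) : f x = 0 := by
  have hb := Metric.isOpen_ball.mem_nhds hx
  have hcont : ContinuousAt f x := h.continuousOn.continuousAt
    (Filter.mem_of_superset hb Metric.ball_subset_closedBall)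
  rw [frontier_eq_closure_inter_closure] at hE
  by_contra hne
  rcases lt_or_gt_of_ne hne with hlt | hgt
  · have hev : ∀ᶠ y in 𝓝 x, y ∈ E := by
      filter_upwards [hb, hcont.eventually_lt continuousAt_const hlt] with y hy hy'
      exact h.mem_of_neg y (Metric.ball_subset_closedBall hy) hy'
    obtain ⟨y, hy1, hy2⟩ := ((mem_closure_iff_frequently.1 hE.2).and_eventually hev).exists
    exact hy1 hy2
  · have hev : ∀ᶠ y in 𝓝 x, y ∉ E := by
      filter_upwards [hb, continuousAt_const.eventually_lt hcont hgt] with y hy hy'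
      exact h.notMem_of_pos y (Metric.ball_subset_closedBall hy) hy'
    obtain ⟨y, hy1, hy2⟩ := ((mem_closure_iff_frequently.1 hE.1).and_eventually hev).exists
    exact hy2 hy1

end IsLocalChart

/-- A `C²` defining function yields a local chart in any direction in which its derivative is
positive. -/
theorem IsC2DefiningFunction.exists_isLocalChart {d : ℕ} {E : Set (EuclideanSpace ℝ (Fin d))}
    {p v : EuclideanSpace ℝ (Fin d)} {f : EuclideanSpace ℝ (Fin d) → ℝ}
    (hf : IsC2DefiningFunction E p f) (hv : ‖v‖ = 1) (hpos : 0 < fderiv ℝ f p v) :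
    ∃ R c C, IsLocalChart E p v f (fderiv ℝ f) R c C := by
  have h1 : ContDiffAt ℝ 1 (fderiv ℝ f) p := hf.contDiffAt.fderiv_right (by norm_num)
  obtain ⟨K, t, ht, hK⟩ := h1.exists_lipschitzOnWith
  -- The derivative along `v` is `4c` at `p` and stays above `2c` nearby; one `c` is then spent on
  -- the Taylor error in `mono`.
  set c := fderiv ℝ f p v / 4 with hc
  have hcpos : 0 < c := by positivity
  have hev : ∀ᶠ x in 𝓝 p, ContDiffAt ℝ 2 f x ∧ x ∈ t ∧ 2 * c < fderiv ℝ f x v ∧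
      ‖fderiv ℝ f x‖ < ‖fderiv ℝ f p‖ + 1 ∧ (f x < 0 → x ∈ E) ∧ (0 < f x → x ∉ E) := by
    have e1 : ∀ᶠ x in 𝓝 p, ContDiffAt ℝ 2 f x := hf.contDiffAt.eventually (by simp)
    have hcont : ContinuousAt (fderiv ℝ f) p := h1.continuousAt
    have e2 : ∀ᶠ x in 𝓝 p, 2 * c < fderiv ℝ f x v :=
      continuousAt_const.eventually_lt (hcont.clm_apply continuousAt_const) (by rw [hc]; linarith)
    have e3 : ∀ᶠ x in 𝓝 p, ‖fderiv ℝ f x‖ < ‖fderiv ℝ f p‖ + 1 :=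
      hcont.norm.eventually_lt continuousAt_const (by linarith)
    filter_upwards [e1, ht, e2, e3, hf.mem_of_neg, hf.notMem_of_pos] with x a1 a2 a3 a4 a5 a6
    exact ⟨a1, a2, a3, a4, a5, a6⟩
  obtain ⟨R₀, hR₀, hball⟩ := Metric.nhds_basis_closedBall.mem_iff.1 hev
  -- One constant serves both as gradient bound and as Taylor constant.
  set C := ‖fderiv ℝ f p‖ + 1 + K with hC
  have hCpos : 0 < C := by positivity
  -- Two points of the ball are at most `2R` apart, so a displacement `δ` along `v` satisfies `C δ ≤
  -- c` and its Taylor error `C δ²` is at most `c δ`.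
  set R := min R₀ (c / (2 * C)) with hR
  have hRpos : 0 < R := lt_min hR₀ (by positivity)
  have hRC : C * (2 * R) ≤ c := by
    have : R ≤ c / (2 * C) := min_le_right _ _
    rw [le_div_iff₀ (by positivity)] at this
    linarith
  have hB : ∀ x ∈ Metric.closedBall p R, ContDiffAt ℝ 2 f x ∧ x ∈ t ∧ 2 * c < fderiv ℝ f x v ∧
      ‖fderiv ℝ f x‖ < ‖fderiv ℝ f p‖ + 1 ∧ (f x < 0 → x ∈ E) ∧ (0 < f x → x ∉ E) :=
    fun x hx => hball (Metric.closedBall_subset_closedBall (min_le_left _ _) hx)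
  have hdiff : ∀ x ∈ Metric.closedBall p R, DifferentiableAt ℝ f x :=
    fun x hx => (hB x hx).1.differentiableAt (by norm_num)
  have htaylor : ∀ x ∈ Metric.closedBall p R, ∀ y ∈ Metric.closedBall p R,
      |f y - f x - fderiv ℝ f x (y - x)| ≤ C * ‖y - x‖ ^ 2 := by
    intro x hx y hy
    have hseg : segment ℝ x y ⊆ Metric.closedBall p R :=
      (convex_closedBall p R).segment_subset hx hy
    have := (convex_segment x y).norm_image_sub_le_of_norm_fderiv_le'
      (f := f) (C := K * ‖y - x‖) (φ := fderiv ℝ f x) (fun w hw => hdiff w (hseg hw))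
      (fun w hw => by
        refine (hK.norm_sub_le (hB w (hseg hw)).2.1 (hB x hx).2.1).trans ?_
        gcongr
        exact norm_sub_le_of_mem_segment hw)
      (left_mem_segment ℝ x y) (right_mem_segment ℝ x y)
    rw [Real.norm_eq_abs] at this
    refine this.trans ?_
    have hKC : (K : ℝ) ≤ C := by rw [hC]; linarith [norm_nonneg (fderiv ℝ f p)]
    calc (K : ℝ) * ‖y - x‖ * ‖y - x‖ = K * ‖y - x‖ ^ 2 := by ring
      _ ≤ C * ‖y - x‖ ^ 2 := by gcongr
  refine ⟨R, c, C, hRpos, hcpos, hCpos, fun x hx => (hdiff x hx).continuousAt.continuousWithinAt,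
    fun x hx => (hB x hx).2.2.2.1.le.trans (by rw [hC]; linarith [K.coe_nonneg]),
    fun x hx => by linarith [(hB x hx).2.2.1], htaylor, fun x hx δ hδ hy => ?_,
    fun x hx => (hB x hx).2.2.2.2.1, fun x hx => (hB x hx).2.2.2.2.2⟩
  have h2 := htaylor x hx _ hy
  have h3 := (hB x hx).2.2.1
  have hn : ‖δ • v‖ = δ := by rw [norm_smul, hv, mul_one, Real.norm_of_nonneg hδ]
  have hδR : δ ≤ 2 * R := by
    have h4 : dist (x + δ • v) x ≤ R + R :=
      (dist_triangle_right _ _ p).trans (add_le_add hy hx)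
    rw [dist_eq_norm, add_sub_cancel_left, hn] at h4
    linarith
  rw [add_sub_cancel_left, hn, map_smul, smul_eq_mul] at h2
  have h5 := (abs_le.1 h2).1
  have h6 : C * δ ≤ c := (by gcongr : C * δ ≤ C * (2 * R)).trans hRC
  nlinarith

/-- Sections of a set in the direction `v = ± e_i`. -/
theorem section_diam_le {n : ℕ} {i : Fin (n + 1)} {θ : ℝ} (hθ : θ * θ = 1)
    {A : Set (EuclideanSpace ℝ (Fin (n + 1)))} {w : (Fin n → ℝ) → ℝ}
    (h : ∀ z ∈ A, ∀ δ : ℝ, 0 ≤ δ → z + δ • (θ • EuclideanSpace.single i (1 : ℝ)) ∈ A →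
      δ ≤ w (dropCoord i z)) :
    ∀ z₁ ∈ A, ∀ z₂ ∈ A, dropCoord i z₁ = dropCoord i z₂ → |z₁ i - z₂ i| ≤ w (dropCoord i z₁) := by
  intro z₁ h₁ z₂ h₂ heq
  have e₁ := eq_add_smul_single_of_dropCoord_eq heq
  have e₂ := eq_add_smul_single_of_dropCoord_eq heq.symm
  have hθ' : |θ| = 1 := by
    rcases mul_self_eq_one_iff.1 hθ with rfl | rfl <;> simp
  have habs : |θ * (z₁ i - z₂ i)| = |z₁ i - z₂ i| := by rw [abs_mul, hθ', one_mul]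
  rcases le_total 0 (θ * (z₁ i - z₂ i)) with hs | hs
  · have := h z₂ h₂ _ hs (by
      rw [smul_smul, mul_right_comm, hθ, one_mul, ← e₁]; exact h₁)
    rwa [← habs, abs_of_nonneg hs, heq]
  · have := h z₁ h₁ (-(θ * (z₁ i - z₂ i))) (by linarith) (by
      rw [smul_smul, neg_mul, mul_right_comm, hθ, one_mul, neg_sub, ← e₂]; exact h₂)
    rwa [← habs, abs_of_nonpos hs]

theorem norm_smul_single {n : ℕ} {i : Fin (n + 1)} {θ : ℝ} (hθ : θ * θ = 1) :
    ‖θ • EuclideanSpace.single i (1 : ℝ)‖ = 1 := by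
  rcases mul_self_eq_one_iff.1 hθ with rfl | rfl <;> simp

theorem fderiv_single_eq_gradient {d : ℕ} (f : EuclideanSpace ℝ (Fin d) → ℝ)
    (p : EuclideanSpace ℝ (Fin d)) (i : Fin d) :
    fderiv ℝ f p (EuclideanSpace.single i (1 : ℝ)) = gradient f p i := by
  have := InnerProductSpace.toDual_symm_apply (𝕜 := ℝ) (x := EuclideanSpace.single i (1 : ℝ))
    (y := fderiv ℝ f p)
  rw [EuclideanSpace.inner_single_right] at this
  simpa [gradient] using this.symm

/-- A defining function has positive derivative in the direction `± e_i` for some sign, if its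
gradient has a nonzero `i`-th component. -/
theorem exists_sign_fderiv_pos {d : ℕ} {f : EuclideanSpace ℝ (Fin d) → ℝ}
    {p : EuclideanSpace ℝ (Fin d)} {i : Fin d} (hi : gradient f p i ≠ 0) :
    ∃ θ : ℝ, θ * θ = 1 ∧ 0 < fderiv ℝ f p (θ • EuclideanSpace.single i (1 : ℝ)) := by
  have h := fderiv_single_eq_gradient f p i
  rcases lt_or_gt_of_ne hi with hneg | hpos
  · exact ⟨-1, by norm_num, by rw [map_smul, h, smul_eq_mul]; linarith⟩
  · exact ⟨1, by norm_num, by rw [map_smul, h, smul_eq_mul]; linarith⟩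

/-! ### Null boundary and measurability -/

/-- The boundary of a set with `C²` boundary is Lebesgue negligible. -/
theorem HasC2Boundary.volume_frontier {n : ℕ} {E : Set (EuclideanSpace ℝ (Fin (n + 1)))}
    (hE : HasC2Boundary E) : volume (frontier E) = 0 := by
  refine measure_null_of_locally_null _ fun p hp => ?_
  obtain ⟨f, hf⟩ := hE p hp
  obtain ⟨i, hi⟩ : ∃ i, gradient f p i ≠ 0 := by
    by_contra! hcon
    exact hf.gradient_ne_zero (PiLp.ext hcon)
  obtain ⟨θ, hθ, hpos⟩ := exists_sign_fderiv_pos hi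
  obtain ⟨R, c, C, hch⟩ := hf.exists_isLocalChart (norm_smul_single hθ) hpos
  set A := Metric.closedBall p R ∩ f ⁻¹' {0}
  have hA : MeasurableSet A :=
    (hch.continuousOn.preimage_isClosed_of_isClosed Metric.isClosed_closedBall
      isClosed_singleton).measurableSet
  -- Strict monotonicity along `v` lets each line parallel to `v` meet the zero set at most once:
  -- the sections have diameter `0`.
  have hA0 : volume A = 0 := by
    have := setLIntegral_le_of_section_diam_le i hA (fun _ => 0)
      (section_diam_le (A := A) (w := fun _ => 0) hθ fun z hz δ hδ hz' => by
        have h1 := hch.mono z hz.1 δ hδ hz'.1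
        have h2 : f z = 0 := hz.2
        have h3 : f (z + δ • (θ • EuclideanSpace.single i (1 : ℝ))) = 0 := hz'.2
        rw [h2, h3] at h1
        nlinarith [hch.c_pos]) (fun _ => 1) measurable_const
    simpa using this
  refine ⟨A, ?_, hA0⟩
  filter_upwards [mem_nhdsWithin_of_mem_nhds (Metric.ball_mem_nhds p hch.R_pos),
    self_mem_nhdsWithin] with x hx hxE
  exact ⟨Metric.ball_subset_closedBall hx, hch.eq_zero_of_mem_frontier hx hxE⟩

/-- Since `γ` is arbitrary, measurability of the subgraph has to come from its boundary, which is
negligible. -/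
theorem HasC2Boundary.nullMeasurableSet {n : ℕ} {E : Set (EuclideanSpace ℝ (Fin (n + 1)))}
    (hE : HasC2Boundary E) : NullMeasurableSet E :=
  nullMeasurableSet_of_null_frontier hE.volume_frontier

/-! ### Signed indicators and kernels -/

/-- The function equal to `-1` on `E` and to `1` on its complement. -/
def signedIndicator {W : Type*} (E : Set W) (x : W) : ℝ :=
  Eᶜ.indicator (fun _ => (1 : ℝ)) x - E.indicator (fun _ => (1 : ℝ)) x

/-- The even part (doubled) of `signedIndicator E` around the point `q`. -/
def symmIndicator {W : Type*} [AddGroup W] (E : Set W) (q z : W) : ℝ :=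
  signedIndicator E (q + z) + signedIndicator E (q - z)

/-- The singular kernel `|z|^{-a}`. -/
def singKernel {W : Type*} [Norm W] (a : ℝ) (z : W) : ℝ := ‖z‖ ^ (-a)

/-- The kernel `|z|^{-a}`, truncated to be constant for `|z| ≤ r`. -/
def farKernel {W : Type*} [Norm W] (a r : ℝ) (z : W) : ℝ := (max ‖z‖ r) ^ (-a)

section Indicator

variable {W : Type*} {E : Set W}

theorem signedIndicator_of_mem {x : W} (hx : x ∈ E) : signedIndicator E x = -1 := by
  simp [signedIndicator, hx]

theorem signedIndicator_of_notMem {x : W} (hx : x ∉ E) : signedIndicator E x = 1 := by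
  simp [signedIndicator, hx]

theorem abs_signedIndicator (x : W) : |signedIndicator E x| = 1 := by
  by_cases hx : x ∈ E
  · simp [signedIndicator_of_mem hx]
  · simp [signedIndicator_of_notMem hx]

theorem abs_symmIndicator_le [AddGroup W] (q z : W) : |symmIndicator E q z| ≤ 2 := by
  refine (abs_add_le _ _).trans ?_
  rw [abs_signedIndicator, abs_signedIndicator]; norm_num

end Indicator

theorem singKernel_neg {W : Type*} [SeminormedAddCommGroup W] (a : ℝ) (z : W) :
    singKernel a (-z) = singKernel a z := by simp [singKernel]

theorem farKernel_neg {W : Type*} [SeminormedAddCommGroup W] (a r : ℝ) (z : W) :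
    farKernel a r (-z) = farKernel a r z := by simp [farKernel]

theorem singKernel_nonneg {W : Type*} [SeminormedAddCommGroup W] (a : ℝ) (z : W) :
    0 ≤ singKernel a z := Real.rpow_nonneg (norm_nonneg _) _

theorem farKernel_nonneg {W : Type*} [SeminormedAddCommGroup W] (a r : ℝ) (z : W) :
    0 ≤ farKernel a r z := Real.rpow_nonneg (le_max_of_le_left (norm_nonneg _)) _

theorem farKernel_eq_singKernel {W : Type*} [SeminormedAddCommGroup W] {a r : ℝ} {z : W}
    (h : r ≤ ‖z‖) : farKernel a r z = singKernel a z := by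
  rw [farKernel, singKernel, max_eq_left h]

/-- The origin is excluded because `0 ^ (-a) = 0` for `a ≠ 0`, which would break the inequality when
`r > 0`. -/
theorem farKernel_le_singKernel {W : Type*} [NormedAddCommGroup W] {a r : ℝ} (ha : 0 ≤ a) {z : W}
    (hz : z ≠ 0) : farKernel a r z ≤ singKernel a z :=
  Real.rpow_le_rpow_of_nonpos (norm_pos_iff.2 hz) (le_max_left _ _) (by linarith)

theorem measurable_singKernel {W : Type*} [NormedAddCommGroup W] [MeasurableSpace W] [BorelSpace W]
    (a : ℝ) : Measurable (singKernel a : W → ℝ) :=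
  measurable_norm.pow_const _

theorem continuous_farKernel {W : Type*} [NormedAddCommGroup W] {a r : ℝ} (hr : 0 < r) :
    Continuous (farKernel a r : W → ℝ) :=
  (continuous_norm.max continuous_const).rpow_const
    fun _ => Or.inl (lt_max_of_lt_right hr).ne'

/-- Negative powers vary little under small relative changes of the argument. -/
theorem exists_abs_rpow_neg_sub_le {a : ℝ} (ha : 0 < a) :
    ∃ C : ℝ, 0 ≤ C ∧ ∀ u v δ : ℝ, 0 < u → δ ≤ 1 / 2 → |v - u| ≤ δ * u →
      |v ^ (-a) - u ^ (-a)| ≤ C * δ * u ^ (-a) := by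
  -- By homogeneity only the ratio `x = v / u ∈ [1/2, 3/2]` matters; the constant is the largest
  -- slope of `y ^ (-a)` there, attained at `1/2`.
  refine ⟨a * (1 / 2 : ℝ) ^ (-a - 1), by positivity, fun u v δ hu hδ hv => ?_⟩
  set x := v / u with hx
  have hvx : v = u * x := by rw [hx]; field_simp
  have hx1 : |x - 1| ≤ δ := by
    have : x - 1 = (v - u) / u := by rw [hx]; field_simp
    rw [this, abs_div, abs_of_pos hu, div_le_iff₀ hu]; exact hv
  have hx0 : x ∈ Icc (1 / 2 : ℝ) (3 / 2) := by
    have := abs_le.1 hx1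
    constructor <;> linarith
  have hmvt := (convex_Icc (1 / 2 : ℝ) (3 / 2)).norm_image_sub_le_of_norm_hasDerivWithin_le
    (f := fun y : ℝ => y ^ (-a)) (f' := fun y => -a * y ^ (-a - 1))
    (C := a * (1 / 2 : ℝ) ^ (-a - 1))
    (fun y hy => (Real.hasDerivAt_rpow_const
      (Or.inl (by linarith [hy.1] : (0 : ℝ) < y).ne')).hasDerivWithinAt)
    (fun y hy => by
      have hy0 : (0 : ℝ) < y := by linarith [hy.1]
      rw [norm_mul, norm_neg, Real.norm_of_nonneg ha.le,
        Real.norm_of_nonneg (Real.rpow_nonneg hy0.le _)]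
      gcongr a * ?_
      exact Real.rpow_le_rpow_of_nonpos (by norm_num) hy.1 (by linarith))
    (show (1 : ℝ) ∈ Icc (1 / 2 : ℝ) (3 / 2) by constructor <;> norm_num) hx0
  rw [Real.norm_eq_abs, Real.norm_eq_abs, Real.one_rpow] at hmvt
  have hxpos : 0 < x := by linarith [hx0.1]
  rw [hvx, Real.mul_rpow hu.le hxpos.le]
  have : u ^ (-a) * x ^ (-a) - u ^ (-a) = u ^ (-a) * (x ^ (-a) - 1) := by ring
  rw [this, abs_mul, abs_of_nonneg (Real.rpow_nonneg hu.le _), mul_comm]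
  gcongr
  exact hmvt.trans (by gcongr)

theorem integrable_farKernel {n : ℕ} {a r : ℝ} (ha : (n : ℝ) + 1 < a) (hr : 0 < r) :
    Integrable (farKernel a r : EuclideanSpace ℝ (Fin (n + 1)) → ℝ) := by
  have h := integrable_one_add_norm (μ := (volume : Measure (EuclideanSpace ℝ (Fin (n + 1)))))
    (r := a) (by simpa using ha)
  have ha0 : 0 < a := by have := n.cast_nonneg (α := ℝ); linarith
  -- Chosen so that `m (1 + ‖z‖) ≤ max ‖z‖ r` both for `‖z‖ ≤ 1` and for `‖z‖ ≥ 1`.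
  set m := min r 1 / 2 with hm
  have hm0 : 0 < m := by positivity
  refine (h.const_mul (m ^ (-a))).mono' (continuous_farKernel hr).aestronglyMeasurable
    (ae_of_all _ fun z => ?_)
  rw [Real.norm_of_nonneg (farKernel_nonneg _ _ _), ← Real.mul_rpow hm0.le (by positivity)]
  refine Real.rpow_le_rpow_of_nonpos (by positivity) ?_ (by linarith)
  rcases le_total ‖z‖ 1 with h1 | h1
  · refine le_trans ?_ (le_max_right _ _)
    calc m * (1 + ‖z‖) ≤ m * 2 := by gcongr; linarith
      _ ≤ r := by rw [hm]; linarith [min_le_left r 1]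
  · refine le_trans ?_ (le_max_left _ _)
    calc m * (1 + ‖z‖) ≤ (1 / 2) * (2 * ‖z‖) := by
          gcongr
          · rw [hm]; linarith [min_le_right r 1]
          · linarith
      _ = ‖z‖ := by ring

/-! ### From principal values to integrals -/

section Measurability

variable {n : ℕ} {E : Set (EuclideanSpace ℝ (Fin (n + 1)))}

theorem aestronglyMeasurable_signedIndicator (hE : NullMeasurableSet E) :
    AEStronglyMeasurable (signedIndicator E) :=
  (aestronglyMeasurable_const.indicator₀ hE.compl).sub (aestronglyMeasurable_const.indicator₀ hE)

theorem aestronglyMeasurable_signedIndicator_add (hE : NullMeasurableSet E)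
    (q : EuclideanSpace ℝ (Fin (n + 1))) :
    AEStronglyMeasurable fun z => signedIndicator E (q + z) :=
  (aestronglyMeasurable_signedIndicator hE).comp_measurePreserving (measurePreserving_add_left _ q)

theorem aestronglyMeasurable_symmIndicator (hE : NullMeasurableSet E)
    (q : EuclideanSpace ℝ (Fin (n + 1))) : AEStronglyMeasurable (symmIndicator E q) :=
  (aestronglyMeasurable_signedIndicator_add hE q).add
    ((aestronglyMeasurable_signedIndicator hE).comp_measurePreserving
      (Measure.measurePreserving_sub_left _ q))

/-- A bounded measurable weight keeps a kernel integrable. -/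
theorem integrable_signedIndicator_mul (hE : NullMeasurableSet E)
    (q : EuclideanSpace ℝ (Fin (n + 1))) {k : EuclideanSpace ℝ (Fin (n + 1)) → ℝ}
    (hk : Integrable k) : Integrable fun z => signedIndicator E (q + z) * k z :=
  hk.bdd_mul (c := 1) (aestronglyMeasurable_signedIndicator_add hE q)
    (ae_of_all _ fun z => by rw [Real.norm_eq_abs, abs_signedIndicator])

theorem integrable_symmIndicator_mul (hE : NullMeasurableSet E)
    (q : EuclideanSpace ℝ (Fin (n + 1))) {k : EuclideanSpace ℝ (Fin (n + 1)) → ℝ}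
    (hk : Integrable k) : Integrable fun z => symmIndicator E q z * k z :=
  hk.bdd_mul (c := 2) (aestronglyMeasurable_symmIndicator hE q)
    (ae_of_all _ fun z => by rw [Real.norm_eq_abs]; exact abs_symmIndicator_le q z)

/-- Integrals of `symmIndicator` against an even kernel. -/
theorem integral_symmIndicator_mul (hE : NullMeasurableSet E)
    (q : EuclideanSpace ℝ (Fin (n + 1))) {k : EuclideanSpace ℝ (Fin (n + 1)) → ℝ}
    (hk : Integrable k) (heven : ∀ z, k (-z) = k z) :
    ∫ z, symmIndicator E q z * k z = 2 * ∫ z, signedIndicator E (q + z) * k z := by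
  have h1 := integrable_signedIndicator_mul hE q hk
  have h2 : (fun z => symmIndicator E q z * k z) =
      fun z => signedIndicator E (q + z) * k z + signedIndicator E (q + -z) * k (-z) := by
    funext z
    rw [heven, symmIndicator, sub_eq_add_neg]; ring
  rw [h2, integral_add h1 h1.comp_neg,
    integral_neg_eq_self (fun z => signedIndicator E (q + z) * k z) volume]
  ring

/-- If the symmetrized integrand is integrable, a vanishing nonlocal mean curvature is the vanishing
of an honest integral. -/
theorem integral_symmIndicator_mul_singKernel_eq_zero {s : ℝ} (hs : 0 < s)
    (hE : NullMeasurableSet E) {q : EuclideanSpace ℝ (Fin (n + 1))}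
    (hH : HasNonlocalMeanCurvature s E q 0)
    (hint : Integrable fun z => symmIndicator E q z * singKernel ((n + 1 : ℕ) + 2 * s) z) :
    ∫ z, symmIndicator E q z * singKernel ((n + 1 : ℕ) + 2 * s) z = 0 := by
  set a : ℝ := (n + 1 : ℕ) + 2 * s with ha
  set F := fun z => symmIndicator E q z * singKernel a z with hF
  -- The truncated kernel is even and integrable, so symmetrizing the integrand merely doubles the
  -- integral. Dominated convergence then removes the truncation.
  have htrunc : ∀ ρ : ℝ, 0 < ρ → truncatedMeanCurvature s E q ρ =
      (1 / 2) * ∫ z, (Metric.ball 0 ρ)ᶜ.indicator F z := by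
    intro ρ hρ
    have hball : MeasurableSet (Metric.ball (0 : EuclideanSpace ℝ (Fin (n + 1))) ρ)ᶜ :=
      Metric.isOpen_ball.measurableSet.compl
    set k := (Metric.ball (0 : EuclideanSpace ℝ (Fin (n + 1))) ρ)ᶜ.indicator (singKernel a) with hk
    have hkint : Integrable k := by
      have h1 := (integrable_farKernel (n := n) (a := a) (r := ρ)
        (by rw [ha]; push_cast; linarith) hρ).indicator hball
      have h2 : k = (Metric.ball (0 : EuclideanSpace ℝ (Fin (n + 1))) ρ)ᶜ.indicator
          (farKernel a ρ) :=
        indicator_congr fun z hz => (farKernel_eq_singKernel (by simpa using hz)).symm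
      rwa [h2]
    have hkeven : ∀ z, k (-z) = k z := by
      intro z
      have : -z ∈ (Metric.ball (0 : EuclideanSpace ℝ (Fin (n + 1))) ρ)ᶜ ↔
          z ∈ (Metric.ball (0 : EuclideanSpace ℝ (Fin (n + 1))) ρ)ᶜ := by simp
      by_cases hz : z ∈ (Metric.ball (0 : EuclideanSpace ℝ (Fin (n + 1))) ρ)ᶜ
      · rw [hk, indicator_of_mem hz, indicator_of_mem (this.2 hz), singKernel_neg]
      · rw [hk, indicator_of_notMem hz, indicator_of_notMem (fun h => hz (this.1 h))]
    have h2 : (Metric.ball 0 ρ)ᶜ.indicator F = fun z => symmIndicator E q z * k z := by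
      funext z
      by_cases hz : z ∈ (Metric.ball (0 : EuclideanSpace ℝ (Fin (n + 1))) ρ)ᶜ
      · rw [hk, indicator_of_mem hz, indicator_of_mem hz]
      · rw [hk, indicator_of_notMem hz, indicator_of_notMem hz, mul_zero]
    rw [h2, integral_symmIndicator_mul hE q hkint hkeven, truncatedMeanCurvature,
      ← integral_indicator (Metric.isOpen_ball.measurableSet.compl),
      ← integral_add_left_eq_self _ q]
    rw [← mul_assoc, one_div, inv_mul_cancel₀ two_ne_zero, one_mul]
    congr 1 with z
    by_cases hz : z ∈ (Metric.ball (0 : EuclideanSpace ℝ (Fin (n + 1))) ρ)ᶜ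
    · have hz' : q + z ∈ (Metric.ball q ρ)ᶜ := by simpa using hz
      rw [hk, indicator_of_mem hz, indicator_of_mem hz', add_sub_cancel_left, singKernel,
        Real.rpow_neg (norm_nonneg _), div_eq_mul_inv]
      rfl
    · have hz' : q + z ∉ (Metric.ball q ρ)ᶜ := by simpa using hz
      rw [hk, indicator_of_notMem hz, indicator_of_notMem hz', mul_zero]
  have hlim : Tendsto (fun ρ : ℝ => ∫ z, (Metric.ball 0 ρ)ᶜ.indicator F z) (𝓝[>] 0)
      (𝓝 (∫ z, F z)) := by
    refine tendsto_integral_filter_of_dominated_convergence (fun z => ‖F z‖)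
      (Eventually.of_forall fun ρ => hint.aestronglyMeasurable.indicator
        Metric.isOpen_ball.measurableSet.compl)
      (Eventually.of_forall fun ρ => ae_of_all _ fun z => norm_indicator_le_norm_self _ _)
      hint.norm ?_
    filter_upwards [compl_mem_ae_iff.2 (measure_singleton (0 : EuclideanSpace ℝ (Fin (n + 1))))]
      with z hz
    have hz0 : 0 < ‖z‖ := norm_pos_iff.2 hz
    refine tendsto_const_nhds.congr' ?_
    filter_upwards [mem_nhdsWithin_of_mem_nhds (Iio_mem_nhds hz0)] with ρ (hρ : ρ < ‖z‖)
    rw [indicator_of_mem]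
    simpa using hρ.le
  have h3 : Tendsto (truncatedMeanCurvature s E q) (𝓝[>] 0) (𝓝 ((1 / 2) * ∫ z, F z)) := by
    refine (hlim.const_mul (1 / 2)).congr' ?_
    filter_upwards [self_mem_nhdsWithin] with ρ hρ
    exact (htrunc ρ hρ).symm
  have := tendsto_nhds_unique h3 hH
  linarith

end Measurability

/-! ### Uniform integrability near the boundary -/

/-- The coordinate `v = ± e_i` of a vector `z` is controlled by the other ones if `z` is almost
tangent to a hypersurface transversal to `v`. -/
theorem norm_le_of_abs_apply_le {n : ℕ} {i : Fin (n + 1)} {θ c C r : ℝ} (hθ : θ * θ = 1)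
    (hc : 0 < c) (hC : 0 < C) (hr : C * r ≤ c / 2)
    {L : EuclideanSpace ℝ (Fin (n + 1)) →L[ℝ] ℝ} (hL : ‖L‖ ≤ C)
    (hLv : c ≤ L (θ • EuclideanSpace.single i (1 : ℝ)))
    {z : EuclideanSpace ℝ (Fin (n + 1))} (hz : ‖z‖ ≤ r) (hLz : |L z| ≤ C * ‖z‖ ^ 2) :
    ‖z‖ ≤ (2 + 2 * C / c) * (n + 1) * ‖dropCoord i z‖ := by
  set v := θ • EuclideanSpace.single i (1 : ℝ) with hv
  set τ := θ * z i with hτ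
  set y := z - τ • v with hy
  have hyi : τ • v = (z i) • EuclideanSpace.single i (1 : ℝ) := by
    rw [hv, smul_smul, hτ, mul_right_comm, hθ, one_mul]
  have hynorm : ‖y‖ ≤ (n + 1) * ‖dropCoord i z‖ := by
    refine abs_le_of_sq_le_sq' ?_ (by positivity) |>.2
    rw [EuclideanSpace.norm_sq_eq]
    calc ∑ j, ‖y j‖ ^ 2 ≤ ∑ _j : Fin (n + 1), ‖dropCoord i z‖ ^ 2 := by
          refine Finset.sum_le_sum fun j _ => ?_
          gcongr
          rcases Fin.eq_self_or_eq_succAbove i j with rfl | ⟨k, rfl⟩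
          · rw [hy, hyi]; simp
          · have : y (i.succAbove k) = dropCoord i z k := by
              rw [hy, hyi]; simp [dropCoord, Fin.succAbove_ne]
            rw [this]
            exact norm_le_pi_norm _ k
      _ = (n + 1) * ‖dropCoord i z‖ ^ 2 := by simp
      _ ≤ ((n + 1) * ‖dropCoord i z‖) ^ 2 := by
          rw [mul_pow]
          gcongr
          nlinarith [n.cast_nonneg (α := ℝ)]
  have hzy : z = y + τ • v := by rw [hy]; abel
  have hvn : ‖v‖ = 1 := norm_smul_single hθ
  have hzn : ‖z‖ ≤ ‖y‖ + |τ| := by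
    conv_lhs => rw [hzy]
    refine (norm_add_le _ _).trans ?_
    rw [norm_smul, hvn, mul_one, Real.norm_eq_abs]
  have hLy : |L y| ≤ C * ‖y‖ := by
    refine (L.le_opNorm y).trans ?_
    gcongr
  have h1 : c * |τ| ≤ |L z| + |L y| := by
    have h2 : τ * L v = L z - L y := by
      rw [hy, map_sub, L.map_smul τ v, smul_eq_mul]; ring
    calc c * |τ| ≤ L v * |τ| := by gcongr
      _ = |τ * L v| := by rw [abs_mul τ, abs_of_pos (hc.trans_le hLv), mul_comm]
      _ = |L z - L y| := by rw [h2]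
      _ ≤ |L z| + |L y| := abs_sub _ _
  -- The smallness `C r ≤ c / 2` makes the quadratic term linear with a coefficient small enough to
  -- be absorbed in `c * |τ|`.
  have h3 : C * ‖z‖ ^ 2 ≤ c / 2 * (‖y‖ + |τ|) := by
    calc C * ‖z‖ ^ 2 = (C * ‖z‖) * ‖z‖ := by ring
      _ ≤ (C * r) * (‖y‖ + |τ|) := by gcongr; exact mul_nonneg hC.le ((norm_nonneg z).trans hz)
      _ ≤ c / 2 * (‖y‖ + |τ|) := by gcongr
  have h4 : |τ| ≤ (1 + 2 * C / c) * ‖y‖ := by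
    have : c * |τ| ≤ c * ((1 + 2 * C / c) * ‖y‖) := by
      have e : c * ((1 + 2 * C / c) * ‖y‖) = c * ‖y‖ + 2 * (C * ‖y‖) := by field_simp
      rw [e]; linarith
    exact le_of_mul_le_mul_left this hc
  calc ‖z‖ ≤ ‖y‖ + |τ| := hzn
    _ ≤ (2 + 2 * C / c) * ‖y‖ := by linarith
    _ ≤ (2 + 2 * C / c) * ((n + 1) * ‖dropCoord i z‖) := by gcongr
    _ = _ := by ring

/-- Near a boundary point with a local chart, the symmetrized singular integrand is integrable,
uniformly in the base point. -/
theorem IsLocalChart.exists_lintegral_symmIndicator_le {n : ℕ} (hn : 0 < n) {a : ℝ}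
    (ha1 : (n : ℝ) + 1 < a) (ha2 : a < n + 2) {E : Set (EuclideanSpace ℝ (Fin (n + 1)))}
    {p : EuclideanSpace ℝ (Fin (n + 1))} {i : Fin (n + 1)} {θ : ℝ} (hθ : θ * θ = 1)
    {f : EuclideanSpace ℝ (Fin (n + 1)) → ℝ}
    {G : EuclideanSpace ℝ (Fin (n + 1)) → EuclideanSpace ℝ (Fin (n + 1)) →L[ℝ] ℝ} {R c C : ℝ}
    (h : IsLocalChart E p (θ • EuclideanSpace.single i (1 : ℝ)) f G R c C) :
    ∃ M : ℝ, 0 ≤ M ∧ ∀ q ∈ Metric.closedBall p (R / 2), f q = 0 →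
      ∫⁻ z, ENNReal.ofReal (|symmIndicator E q z| * singKernel a z) ≤ ENNReal.ofReal M := by
  -- The first bound keeps `q + z` in the chart, the second is the smallness needed in
  -- `norm_le_of_abs_apply_le`.
  set r := min (R / 2) (c / (2 * C)) with hr
  have hR := h.R_pos
  have hc := h.c_pos
  have hC := h.C_pos
  have ha0 : 0 < a := by have := n.cast_nonneg (α := ℝ); linarith
  have hr0 : 0 < r := by positivity
  have hrC : C * r ≤ c / 2 := by
    have : r ≤ c / (2 * C) := min_le_right _ _
    rw [le_div_iff₀ (by positivity)] at this
    linarith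
  obtain ⟨M₁, hM₁, hlayer⟩ := exists_setLIntegral_kernel_layer_le hn ha0 ha2 r
  set Λ := (2 + 2 * C / c) * (n + 1) with hΛ
  set w := 2 * C * Λ ^ 2 / c with hw
  have hw0 : 0 ≤ w := by positivity
  set M₂ := ∫ z : EuclideanSpace ℝ (Fin (n + 1)), farKernel a r z with hM₂
  have hM₂0 : 0 ≤ M₂ := integral_nonneg (farKernel_nonneg a r)
  refine ⟨2 * (w * M₁) + 2 * M₂, by positivity, fun q hq hfq => ?_⟩
  have hqR : q ∈ Metric.closedBall p R :=
    Metric.closedBall_subset_closedBall (by linarith) hq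
  -- Within the ball but off `A`, the linear part `G q z` decides the sign of `f (q + z)`. It is odd
  -- in `z`, so exactly one of `q + z`, `q - z` lies in `E` and the symmetrized indicator vanishes.
  set A := {z ∈ Metric.closedBall (0 : EuclideanSpace ℝ (Fin (n + 1))) r |
    |G q z| ≤ C * ‖z‖ ^ 2} with hA
  have hAm : MeasurableSet A := by
    have hcl : IsClosed {z | |G q z| ≤ C * ‖z‖ ^ 2} :=
      isClosed_le (G q).continuous.abs (by fun_prop)
    exact (Metric.isClosed_closedBall.inter hcl).measurableSet
  have hmemR : ∀ z : EuclideanSpace ℝ (Fin (n + 1)), ‖z‖ ≤ r → q + z ∈ Metric.closedBall p R := by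
    intro z hz
    have h1 : dist (q + z) p ≤ dist (q + z) q + dist q p := dist_triangle _ _ _
    rw [dist_self_add_left] at h1
    have h2 : dist q p ≤ R / 2 := hq
    have h3 : r ≤ R / 2 := min_le_left _ _
    rw [Metric.mem_closedBall]
    linarith
  have hgt : ∀ z : EuclideanSpace ℝ (Fin (n + 1)), ‖z‖ ≤ r → C * ‖z‖ ^ 2 < G q z →
      q + z ∉ E := by
    intro z hz hGz
    have := h.taylor q hqR _ (hmemR z hz)
    rw [add_sub_cancel_left, hfq] at this
    exact h.notMem_of_pos _ (hmemR z hz) (by linarith [(abs_le.1 this).1])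
  have hlt : ∀ z : EuclideanSpace ℝ (Fin (n + 1)), ‖z‖ ≤ r → C * ‖z‖ ^ 2 < -G q z →
      q + z ∈ E := by
    intro z hz hGz
    have := h.taylor q hqR _ (hmemR z hz)
    rw [add_sub_cancel_left, hfq] at this
    exact h.mem_of_neg _ (hmemR z hz) (by linarith [(abs_le.1 this).2])
  have hzero : ∀ z, ‖z‖ ≤ r → z ∉ A → symmIndicator E q z = 0 := by
    intro z hz hzA
    have hzA' : C * ‖z‖ ^ 2 < |G q z| := by
      by_contra hcon
      exact hzA ⟨by simpa using hz, not_lt.1 hcon⟩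
    have hz' : ‖-z‖ ≤ r := by rwa [norm_neg]
    rw [symmIndicator, sub_eq_add_neg]
    rcases lt_abs.1 hzA' with hpos | hneg
    · rw [signedIndicator_of_notMem (hgt z hz hpos), signedIndicator_of_mem
        (hlt (-z) hz' (by rw [norm_neg, map_neg, neg_neg]; exact hpos))]
      norm_num
    · rw [signedIndicator_of_mem (hlt z hz hneg), signedIndicator_of_notMem
        (hgt (-z) hz' (by rw [norm_neg, map_neg]; exact hneg))]
      norm_num
  -- Moving by `δ v` raises `G q` by at least `c δ`, but on `A` its size is at most `C ‖z‖²`, which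
  -- is controlled by the transversal coordinates alone.
  have hsec : ∀ z ∈ A, ∀ δ : ℝ, 0 ≤ δ → z + δ • (θ • EuclideanSpace.single i (1 : ℝ)) ∈ A →
      δ ≤ w * ‖dropCoord i z‖ ^ 2 := by
    intro z hz δ hδ hz'
    set v := θ • EuclideanSpace.single i (1 : ℝ) with hv
    have hdrop : dropCoord i (z + δ • v) = dropCoord i z := by
      funext j
      simp [dropCoord, hv, Fin.succAbove_ne]
    have hb : ∀ y ∈ A, ‖y‖ ≤ Λ * ‖dropCoord i y‖ := fun y hy =>
      norm_le_of_abs_apply_le hθ hc hC hrC (h.norm_le q hqR) (h.le_apply q hqR)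
        (by simpa using hy.1) hy.2
    have h1 := hb z hz
    have h2 := hb _ hz'
    rw [hdrop] at h2
    have h3 : δ * c ≤ δ * G q v := by
      gcongr
      exact h.le_apply q hqR
    have h4 : δ * G q v = G q (z + δ • v) - G q z := by
      rw [map_add, (G q).map_smul δ v, smul_eq_mul]; ring
    have h5 := (abs_le.1 hz.2).1
    have h6 := (abs_le.1 hz'.2).2
    have h7 : C * ‖z‖ ^ 2 ≤ C * (Λ * ‖dropCoord i z‖) ^ 2 := by gcongr
    have h8 : C * ‖z + δ • v‖ ^ 2 ≤ C * (Λ * ‖dropCoord i z‖) ^ 2 := by gcongr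
    have h9 : δ * c ≤ 2 * C * Λ ^ 2 * ‖dropCoord i z‖ ^ 2 := by
      have : 2 * C * Λ ^ 2 * ‖dropCoord i z‖ ^ 2 = 2 * (C * (Λ * ‖dropCoord i z‖) ^ 2) := by ring
      rw [this]; linarith
    rw [hw, div_mul_eq_mul_div, le_div_iff₀ hc]
    exact h9
  have hA1 := hlayer i A w hAm (fun z hz => hz.1) hw0 (section_diam_le (w := fun y => w * ‖y‖ ^ 2)
    hθ hsec)
  have hfar : ∫⁻ z : EuclideanSpace ℝ (Fin (n + 1)), ENNReal.ofReal (farKernel a r z) =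
      ENNReal.ofReal M₂ :=
    (ofReal_integral_eq_lintegral_ofReal (integrable_farKernel ha1 hr0)
      (ae_of_all _ (farKernel_nonneg a r))).symm
  calc ∫⁻ z, ENNReal.ofReal (|symmIndicator E q z| * singKernel a z)
      ≤ ∫⁻ z, (2 * A.indicator (fun z => ENNReal.ofReal (‖z‖ ^ (-a))) z +
          2 * ENNReal.ofReal (farKernel a r z)) := by
        refine lintegral_mono fun z => ?_
        have hk := singKernel_nonneg a z
        have h2 : ENNReal.ofReal (|symmIndicator E q z| * singKernel a z) ≤
            2 * ENNReal.ofReal (singKernel a z) := by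
          have e2 : ENNReal.ofReal (2 * singKernel a z) = 2 * ENNReal.ofReal (singKernel a z) := by
            rw [ENNReal.ofReal_mul (by norm_num), ENNReal.ofReal_ofNat]
          refine (ENNReal.ofReal_le_ofReal ?_).trans e2.le
          gcongr
          exact abs_symmIndicator_le q z
        by_cases hzA : z ∈ A
        · rw [indicator_of_mem hzA]
          exact h2.trans le_self_add
        · rcases le_total ‖z‖ r with hz | hz
          · simp [hzero z hz hzA]
          · rw [farKernel_eq_singKernel hz]
            exact h2.trans le_add_self
    _ = 2 * (∫⁻ z in A, ENNReal.ofReal (‖z‖ ^ (-a))) +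
          2 * ∫⁻ z : EuclideanSpace ℝ (Fin (n + 1)), ENNReal.ofReal (farKernel a r z) := by
        rw [lintegral_add_right _ ((continuous_farKernel hr0).measurable.ennreal_ofReal.const_mul 2),
          lintegral_const_mul' _ _ (by norm_num), lintegral_const_mul' _ _ (by norm_num),
          lintegral_indicator hAm]
    _ ≤ 2 * ENNReal.ofReal (w * M₁) + 2 * ENNReal.ofReal M₂ := by
        rw [hfar]; gcongr
    _ = ENNReal.ofReal (2 * (w * M₁) + 2 * M₂) := by
        rw [ENNReal.ofReal_add (by positivity) (by positivity), ENNReal.ofReal_mul (p := 2)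
          (by norm_num), ENNReal.ofReal_mul (p := 2) (by norm_num), ENNReal.ofReal_ofNat]

/-! ### The quadratic form of the paraboloid -/

/-- The inner product of the parts of `x` and `y` orthogonal to the `i`-th axis. -/
def dropInner {n : ℕ} (i : Fin (n + 1)) (x y : EuclideanSpace ℝ (Fin (n + 1))) : ℝ :=
  ∑ j, dropCoord i x j * dropCoord i y j

section DropInner

variable {n : ℕ} {i : Fin (n + 1)}

theorem dropCoord_smul_single (δ : ℝ) :
    dropCoord i (δ • EuclideanSpace.single i (1 : ℝ)) = 0 := by
  funext j
  simp [dropCoord, Fin.succAbove_ne]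

theorem dropInner_comm (x y : EuclideanSpace ℝ (Fin (n + 1))) :
    dropInner i x y = dropInner i y x := by
  simp only [dropInner, mul_comm]

theorem dropInner_add_right (x y z : EuclideanSpace ℝ (Fin (n + 1))) :
    dropInner i x (y + z) = dropInner i x y + dropInner i x z := by
  simp only [dropInner, dropCoord_add, Pi.add_apply, mul_add, Finset.sum_add_distrib]

theorem dropInner_smul_right (c : ℝ) (x y : EuclideanSpace ℝ (Fin (n + 1))) :
    dropInner i x (c • y) = c * dropInner i x y := by
  simp only [dropInner, dropCoord_smul, Pi.smul_apply, smul_eq_mul, Finset.mul_sum]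
  exact Finset.sum_congr rfl fun j _ => by ring

theorem dropInner_single_right (x : EuclideanSpace ℝ (Fin (n + 1))) (c : ℝ) :
    dropInner i x (c • EuclideanSpace.single i (1 : ℝ)) = 0 := by
  simp [dropInner, dropCoord_smul_single]

theorem dropInner_add_self (x z : EuclideanSpace ℝ (Fin (n + 1))) :
    dropInner i (x + z) (x + z) =
      dropInner i x x + 2 * dropInner i x z + dropInner i z z := by
  rw [dropInner_add_right, dropInner_comm (x + z) x, dropInner_comm (x + z) z,
    dropInner_add_right, dropInner_add_right, dropInner_comm z x]
  ring

theorem dropInner_self_nonneg (x : EuclideanSpace ℝ (Fin (n + 1))) : 0 ≤ dropInner i x x :=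
  Finset.sum_nonneg fun _ _ => mul_self_nonneg _

theorem abs_dropInner_le (x y : EuclideanSpace ℝ (Fin (n + 1))) :
    |dropInner i x y| ≤ n * (‖dropCoord i x‖ * ‖dropCoord i y‖) := by
  calc |dropInner i x y| ≤ ∑ j, |dropCoord i x j * dropCoord i y j| :=
        Finset.abs_sum_le_sum_abs _ _
    _ ≤ ∑ _j : Fin n, ‖dropCoord i x‖ * ‖dropCoord i y‖ := by
        refine Finset.sum_le_sum fun j _ => ?_
        rw [abs_mul]
        exact mul_le_mul (norm_le_pi_norm (dropCoord i x) j) (norm_le_pi_norm (dropCoord i y) j)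
          (abs_nonneg _) (norm_nonneg _)
    _ = n * (‖dropCoord i x‖ * ‖dropCoord i y‖) := by simp

theorem abs_dropInner_le_norm (x y : EuclideanSpace ℝ (Fin (n + 1))) :
    |dropInner i x y| ≤ n * (‖x‖ * ‖y‖) := by
  refine (abs_dropInner_le x y).trans ?_
  gcongr <;> exact norm_dropCoord_le i _

theorem continuous_dropInner_sub (p : EuclideanSpace ℝ (Fin (n + 1))) :
    Continuous fun x => dropInner i (x - p) (x - p) := by
  unfold dropInner dropCoord; fun_prop

/-- Splitting off the `i`-th coordinate. -/
theorem norm_sub_smul_single_sq (z : EuclideanSpace ℝ (Fin (n + 1))) :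
    ‖z - z i • EuclideanSpace.single i (1 : ℝ)‖ ^ 2 = dropInner i z z := by
  rw [EuclideanSpace.norm_sq_eq, Fin.sum_univ_succAbove _ i]
  simp [dropInner, dropCoord, Fin.succAbove_ne, sq]

end DropInner

/-! ### Touching by a perturbed translate -/

namespace IsLocalChart

variable {W : Type*} [NormedAddCommGroup W] [NormedSpace ℝ W] {E : Set W} {p v : W}
  {f : W → ℝ} {G : W → W →L[ℝ] ℝ} {R c C : ℝ}

theorem eventually_pos_sub (h : IsLocalChart E p v f G R c C) {x : W} (hx : x ∈ Metric.ball p R)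
    (hfx : 0 < f x) :
    ∀ᶠ δ : ℝ in 𝓝[>] 0, x - δ • v ∈ Metric.ball p R ∧ 0 < f (x - δ • v) := by
  have hb := Metric.isOpen_ball.mem_nhds hx
  have hcont : ContinuousAt f x := h.continuousOn.continuousAt
    (Filter.mem_of_superset hb Metric.ball_subset_closedBall)
  have hev : ∀ᶠ y in 𝓝 x, y ∈ Metric.ball p R ∧ 0 < f y :=
    (show ∀ᶠ y in 𝓝 x, y ∈ Metric.ball p R from hb).and
      (continuousAt_const.eventually_lt hcont hfx)
  have hlim : Tendsto (fun δ : ℝ => x - δ • v) (𝓝 0) (𝓝 (x - (0 : ℝ) • v)) :=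
    Continuous.tendsto (by fun_prop) 0
  rw [zero_smul, sub_zero] at hlim
  exact (hlim.mono_left nhdsWithin_le_nhds).eventually hev

theorem eventually_neg_add (h : IsLocalChart E p v f G R c C) {x : W} (hx : x ∈ Metric.ball p R)
    (hfx : f x < 0) :
    ∀ᶠ δ : ℝ in 𝓝[>] 0, f (x + δ • v) < 0 := by
  have hb := Metric.isOpen_ball.mem_nhds hx
  have hcont : ContinuousAt f x := h.continuousOn.continuousAt
    (Filter.mem_of_superset hb Metric.ball_subset_closedBall)
  have hlim : Tendsto (fun δ : ℝ => x + δ • v) (𝓝 0) (𝓝 (x + (0 : ℝ) • v)) :=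
    Continuous.tendsto (by fun_prop) 0
  rw [zero_smul, add_zero] at hlim
  exact (hlim.mono_left nhdsWithin_le_nhds).eventually
    (hcont.eventually_lt continuousAt_const hfx)

theorem abs_sub_le (h : IsLocalChart E p v f G R c C) {x y : W} (hx : x ∈ Metric.closedBall p R)
    (hy : y ∈ Metric.closedBall p R) (hxy : ‖y - x‖ ≤ 1) : |f y - f x| ≤ 2 * C * ‖y - x‖ := by
  have h1 := h.taylor x hx y hy
  have h2 : |G x (y - x)| ≤ C * ‖y - x‖ :=
    ((G x).le_opNorm _).trans (mul_le_mul_of_nonneg_right (h.norm_le x hx) (norm_nonneg _))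
  have h3 : C * ‖y - x‖ ^ 2 ≤ C * ‖y - x‖ := by
    have := h.C_pos
    gcongr
    nlinarith [norm_nonneg (y - x)]
  rw [abs_le] at *
  constructor <;> linarith [h1.1, h1.2, h2.1, h2.2]

/-- If `E` is invariant under translation by `-w`, then the sublevel set of the translated
defining function lies in the sublevel set of the original one. -/
theorem nonpos_of_translate_nonpos (h : IsLocalChart E p v f G R c C) {w : W}
    (hE : ∀ y, y + w ∈ E → y ∈ E) {x : W} (hx : x ∈ Metric.ball p R)
    (hxw : x + w ∈ Metric.ball p R) (hf : f (x + w) ≤ 0) : f x ≤ 0 := by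
  by_contra! hpos
  have hlim : Tendsto (fun δ : ℝ => x + w - δ • v) (𝓝 0) (𝓝 (x + w - (0 : ℝ) • v)) :=
    Continuous.tendsto (by fun_prop) 0
  rw [zero_smul, sub_zero] at hlim
  have hev := (hlim.mono_left (nhdsWithin_le_nhds (s := Ioi 0))).eventually
    (Metric.isOpen_ball.mem_nhds hxw)
  obtain ⟨δ, ⟨⟨h1, h2⟩, h3⟩, (h4 : 0 < δ)⟩ :=
    (((h.eventually_pos_sub hx hpos).and hev).and self_mem_nhdsWithin).exists
  have hsub : Metric.ball p R ⊆ Metric.closedBall p R := Metric.ball_subset_closedBall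
  have h5 := h.mono _ (hsub h3) δ h4.le (by rw [sub_add_cancel]; exact hsub hxw)
  rw [sub_add_cancel] at h5
  have h6 : x + w - δ • v ∈ E :=
    h.mem_of_neg _ (hsub h3) (by nlinarith [mul_pos h.c_pos h4])
  have h7 : x - δ • v ∈ E := hE _ (by rwa [sub_add_eq_add_sub])
  exact h.notMem_of_pos _ (hsub h1) h2 h7

end IsLocalChart

set_option maxHeartbeats 1000000 in
/-- **Touching.** Let `e` be tangent at `p` to the boundary of `E`, and let `E` be invariant under
translations by `-t e`, `t ≥ 0`. A small paraboloidal perturbation, of size `O(t²)`, of the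
translate `E - t e` touches `E` from inside at a point near `p`. -/
theorem IsLocalChart.exists_touching {n : ℕ} {E : Set (EuclideanSpace ℝ (Fin (n + 1)))}
    {p v e : EuclideanSpace ℝ (Fin (n + 1))} {i : Fin (n + 1)} {θ : ℝ} (hθ : θ * θ = 1)
    (hv : v = θ • EuclideanSpace.single i (1 : ℝ))
    {f : EuclideanSpace ℝ (Fin (n + 1)) → ℝ}
    {G : EuclideanSpace ℝ (Fin (n + 1)) → EuclideanSpace ℝ (Fin (n + 1)) →L[ℝ] ℝ} {R c C : ℝ}
    (h : IsLocalChart E p v f G R c C) (hfp : f p = 0) (he : ‖e‖ = 1) (hGe : G p e = 0)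
    (hE : ∀ t : ℝ, 0 ≤ t → ∀ y, y + t • e ∈ E → y ∈ E) :
    ∃ t₀ A : ℝ, 0 < t₀ ∧ 0 ≤ A ∧ ∀ t : ℝ, 0 < t → t ≤ t₀ →
      ∃ (Q : EuclideanSpace ℝ (Fin (n + 1))) (τ κ : ℝ), ‖Q - p‖ ≤ R / 8 ∧ 0 ≤ τ ∧ τ ≤ A * t ^ 2 ∧
        0 ≤ κ ∧ κ ≤ A * t ^ 2 ∧ f (Q + t • e) = 0 ∧ f (Q + τ • v) = 0 ∧
        ∀ x ∈ Metric.closedBall p (R / 2), f (x + t • e) ≤ 0 →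
          f (x + (τ - κ * (dropInner i (x - p) (x - p) - dropInner i (Q - p) (Q - p))) • v)
            ≤ 0 := by
  have hR := h.R_pos
  have hc := h.c_pos
  have hC := h.C_pos
  have hvn : ‖v‖ = 1 := by rw [hv]; exact norm_smul_single hθ
  have hnv : ∀ δ : ℝ, ‖δ • v‖ = |δ| := fun δ => by rw [norm_smul, hvn, mul_one, Real.norm_eq_abs]
  have hne : ∀ t : ℝ, ‖t • e‖ = |t| := fun t => by rw [norm_smul, he, mul_one, Real.norm_eq_abs]
  -- the scale of the paraboloid
  obtain ⟨ρ, hρ0, hρ1, hρR, hρC⟩ : ∃ ρ : ℝ, 0 < ρ ∧ ρ ≤ 1 / 2 ∧ ρ ≤ R / 32 ∧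
      2 * C * (2 * ρ) / c ≤ R / 32 := by
    refine ⟨min (min (1 / 2) (R / 32)) (R * c / (128 * C)), by positivity,
      (min_le_left _ _).trans (min_le_left _ _), (min_le_left _ _).trans (min_le_right _ _), ?_⟩
    have : min (min (1 / 2) (R / 32)) (R * c / (128 * C)) ≤ R * c / (128 * C) := min_le_right _ _
    rw [le_div_iff₀ (by positivity)] at this
    rw [div_le_iff₀ hc]
    linarith
  set A := C / c + C / (c * ρ ^ 2) with hA
  have hA0 : 0 ≤ A := by positivity
  obtain ⟨t₀, ht₀, ht₀ρ, ht₀1, ht₀A⟩ : ∃ t₀ : ℝ, 0 < t₀ ∧ t₀ ≤ ρ ∧ t₀ ≤ 1 ∧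
      A * (1 + n * R ^ 2) * t₀ ≤ R / 32 := by
    refine ⟨min (min ρ 1) (R / (32 * (A * (1 + n * R ^ 2) + 1))), by positivity,
      (min_le_left _ _).trans (min_le_left _ _), (min_le_left _ _).trans (min_le_right _ _), ?_⟩
    have h1 : min (min ρ 1) (R / (32 * (A * (1 + n * R ^ 2) + 1))) ≤
        R / (32 * (A * (1 + n * R ^ 2) + 1)) := min_le_right _ _
    have h2 : 0 ≤ min (min ρ 1) (R / (32 * (A * (1 + n * R ^ 2) + 1))) := by positivity
    rw [le_div_iff₀ (by positivity)] at h1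
    nlinarith
  refine ⟨t₀, A, ht₀, hA0, fun t ht htt₀ => ?_⟩
  have htρ : t ≤ ρ := htt₀.trans ht₀ρ
  have ht2 : t ^ 2 ≤ t₀ := by nlinarith
  have hAt : A * (1 + n * R ^ 2) * t ^ 2 ≤ R / 32 :=
    (mul_le_mul_of_nonneg_left ht2 (by positivity)).trans ht₀A
  -- Here `c δ₀ = C t²` is the Taylor bound for `f (p + t e)`: lowering `p + t e` by `δ₀ v` makes
  -- `f` nonpositive.
  set δ₀ := C / c * t ^ 2 with hδ₀
  -- The relation `κ ρ² = δ₀` makes the penalty as large as the value of the competitor at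
  -- transversal distance `ρ`, so the minimum is found within that distance.
  set κ := C / (c * ρ ^ 2) * t ^ 2 with hκ
  have hδ₀0 : 0 ≤ δ₀ := by positivity
  have hκ0 : 0 < κ := by positivity
  have hδ₀A : δ₀ ≤ A * t ^ 2 := by
    rw [hδ₀, hA]; gcongr; exact le_add_of_nonneg_right (by positivity)
  have hκA : κ ≤ A * t ^ 2 := by
    rw [hκ, hA]; gcongr; exact le_add_of_nonneg_left (by positivity)
  have hκρ : κ * ρ ^ 2 = δ₀ := by rw [hκ, hδ₀]; field_simp
  have hnR : (0 : ℝ) ≤ n * R ^ 2 := by positivity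
  have hδ₀R : δ₀ ≤ R / 32 := by
    refine hδ₀A.trans (le_trans ?_ hAt)
    nlinarith [mul_nonneg (mul_nonneg hA0 hnR) (sq_nonneg t)]
  have hκR : κ * (n * R ^ 2) ≤ R / 32 := by
    have h1 : κ * (n * R ^ 2) ≤ A * t ^ 2 * (n * R ^ 2) := by gcongr
    nlinarith [mul_nonneg hA0 (sq_nonneg t)]
  set N := fun x : EuclideanSpace ℝ (Fin (n + 1)) => dropInner i (x - p) (x - p) with hN
  have hNv : ∀ (x : EuclideanSpace ℝ (Fin (n + 1))) (δ : ℝ), N (x + δ • v) = N x := by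
    intro x δ
    have h1 : x + δ • v - p = (x - p) + δ • v := by abel
    simp only [hN]
    rw [h1, dropInner_add_self, hv, smul_smul, dropInner_single_right, dropInner_single_right]
    ring
  set D := Metric.closedBall p (R / 2) with hD
  have hDR : ∀ x ∈ D, ∀ w, ‖w‖ ≤ R / 4 → x + w ∈ Metric.ball p R := by
    intro x hx w hw
    rw [mem_ball_iff_norm]
    have h1 : ‖x - p‖ ≤ R / 2 := by rwa [hD, mem_closedBall_iff_norm] at hx
    have h2 : x + w - p = (x - p) + w := by abel
    rw [h2]
    linarith [norm_add_le (x - p) w]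
  have hsub : Metric.ball p R ⊆ Metric.closedBall p R := Metric.ball_subset_closedBall
  have htR : ‖t • e‖ ≤ R / 4 := by rw [hne, abs_of_pos ht]; linarith
  have hNR : ∀ x ∈ D, N x ≤ n * R ^ 2 := by
    intro x hx
    have h1 : ‖x - p‖ ≤ R := by
      rw [hD, mem_closedBall_iff_norm] at hx; linarith
    refine ((le_abs_self _).trans (abs_dropInner_le_norm _ _)).trans ?_
    rw [← sq]
    gcongr
  -- the compact set of admissible displacements
  set T := {q : EuclideanSpace ℝ (Fin (n + 1)) × ℝ | q ∈ D ×ˢ Icc 0 δ₀ ∧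
    f (q.1 + t • e) ≤ 0 ∧ 0 ≤ f (q.1 + q.2 • v)} with hT
  have hDcomp : IsCompact (D ×ˢ Icc (0 : ℝ) δ₀) :=
    (isCompact_closedBall _ _).prod isCompact_Icc
  have hvR : ∀ τ ∈ Icc 0 δ₀, ‖τ • v‖ ≤ R / 4 := by
    intro τ hτ
    rw [hnv, abs_of_nonneg hτ.1]; linarith [hτ.2]
  have hTcomp : IsCompact T := by
    have hc1 : ContinuousOn (fun q : EuclideanSpace ℝ (Fin (n + 1)) × ℝ => f (q.1 + t • e))
        (D ×ˢ Icc 0 δ₀) :=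
      h.continuousOn.comp (by fun_prop) fun q hq => hsub (hDR _ hq.1 _ htR)
    have hc2 : ContinuousOn (fun q : EuclideanSpace ℝ (Fin (n + 1)) × ℝ => f (q.1 + q.2 • v))
        (D ×ˢ Icc 0 δ₀) :=
      h.continuousOn.comp (by fun_prop) fun q hq => hsub (hDR _ hq.1 _ (hvR _ hq.2))
    have hcl := (hc1.preimage_isClosed_of_isClosed hDcomp.isClosed isClosed_Iic (t := Iic 0)).inter
      (hc2.preimage_isClosed_of_isClosed hDcomp.isClosed isClosed_Ici (t := Ici 0))
    refine hDcomp.of_isClosed_subset ?_ fun q hq => hq.1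
    convert hcl using 1
    ext q
    simp only [hT, mem_ofPred_eq, mem_inter_iff, mem_preimage, mem_Iic, mem_Ici]
    tauto
  have hpD : ∀ w, ‖w‖ ≤ R / 2 → p + w ∈ D := fun w hw => by
    rw [hD, mem_closedBall_iff_norm, add_sub_cancel_left]; exact hw
  have hpR : ∀ w, ‖w‖ ≤ R → p + w ∈ Metric.closedBall p R := fun w hw => by
    rw [mem_closedBall_iff_norm, add_sub_cancel_left]; exact hw
  have hfpt : f (p + t • e) ≤ C * t ^ 2 := by
    have h1 := h.taylor p (Metric.mem_closedBall_self hR.le) (p + t • e)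
      (hpR _ (by linarith))
    rw [add_sub_cancel_left, map_smul, hGe, hfp, hne, abs_of_pos ht] at h1
    have h2 := (abs_le.1 h1).2
    simpa using h2
  have hδv : ‖δ₀ • v‖ ≤ R / 32 := by rw [hnv, abs_of_nonneg hδ₀0]; exact hδ₀R
  have hbase : (p - δ₀ • v, δ₀) ∈ T := by
    refine ⟨⟨?_, hδ₀0, le_rfl⟩, ?_, ?_⟩
    · show p - δ₀ • v ∈ D
      rw [sub_eq_add_neg]
      exact hpD _ (by rw [norm_neg]; linarith)
    · show f (p - δ₀ • v + t • e) ≤ 0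
      have h1 : p - δ₀ • v + t • e ∈ Metric.closedBall p R := by
        rw [sub_eq_add_neg, add_assoc]
        refine hpR _ ((norm_add_le _ _).trans ?_)
        rw [norm_neg]; linarith
      have e1 : p - δ₀ • v + t • e + δ₀ • v = p + t • e := by abel
      have h2 := h.mono _ h1 δ₀ hδ₀0 (by rw [e1]; exact hpR _ (by linarith))
      rw [e1] at h2
      have h3 : c * δ₀ = C * t ^ 2 := by rw [hδ₀]; field_simp
      linarith
    · show 0 ≤ f (p - δ₀ • v + δ₀ • v)
      rw [sub_add_cancel, hfp]
  -- Minimizing the displacement plus the penalty `κ N` finds the first contact of the bent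
  -- translate. The competitor `(p - δ₀ v, δ₀)` has penalty `0`, because `N` ignores displacements
  -- along `v`.
  obtain ⟨⟨Q, τ⟩, hQT, hmin⟩ := hTcomp.exists_isMinOn ⟨_, hbase⟩
    (f := fun q : EuclideanSpace ℝ (Fin (n + 1)) × ℝ => q.2 + κ * N q.1)
    ((continuous_snd.add (continuous_const.mul
      ((continuous_dropInner_sub p).comp continuous_fst))).continuousOn)
  have hmin' : ∀ x τ', (x, τ') ∈ T → τ + κ * N Q ≤ τ' + κ * N x := fun x τ' hx => hmin hx
  obtain ⟨⟨hQD, hτ⟩, hQ1, hQ2⟩ := hQT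
  change Q ∈ D at hQD
  change τ ∈ Icc 0 δ₀ at hτ
  change f (Q + t • e) ≤ 0 at hQ1
  change 0 ≤ f (Q + τ • v) at hQ2
  have hval : τ + κ * N Q ≤ δ₀ := by
    have h1 := hmin' _ _ hbase
    have h2 : N (p - δ₀ • v) = 0 := by
      rw [sub_eq_add_neg, ← neg_smul, hNv]
      simp [hN, dropInner, dropCoord]
    rwa [h2, mul_zero, add_zero] at h1
  have hNQ0 : 0 ≤ N Q := dropInner_self_nonneg _
  have hNQ : N Q ≤ ρ ^ 2 := by
    have h1 : κ * N Q ≤ κ * ρ ^ 2 := by rw [hκρ]; linarith [hτ.1]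
    exact le_of_mul_le_mul_left h1 hκ0
  -- the minimal point is close to `p`
  have hQp : ‖Q - p‖ ≤ R / 8 := by
    set z := Q - p with hz
    set y := z - z i • EuclideanSpace.single i (1 : ℝ) with hy
    have hyρ : ‖y‖ ≤ ρ := by
      refine abs_le_of_sq_le_sq' ?_ hρ0.le |>.2
      rw [hy, norm_sub_smul_single_sq]; exact hNQ
    set η := θ * z i with hη
    have hzy : z = y + η • v := by
      rw [hy, hv, smul_smul, hη, mul_right_comm, hθ, one_mul]; abel
    have hQy : Q = p + y + η • v := by rw [add_assoc, ← hzy, hz]; abel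
    have hzn : ‖z‖ ≤ ρ + |η| := by
      rw [hzy]
      refine (norm_add_le _ _).trans ?_
      rw [hnv]; gcongr
    -- The transversal part of `Q - p` is already at most `ρ`. The component along `v` is bounded
    -- above by `f (Q + t e) ≤ 0`, and below by `f (Q + τ v) ≥ 0`, since `f` grows at rate `c` along
    -- `v`.
    have hup : η ≤ R / 32 := by
      rcases le_or_gt η 0 with hη0 | hη0
      · linarith
      have hw : ‖y + t • e‖ ≤ 2 * ρ := by
        refine (norm_add_le _ _).trans ?_
        rw [hne, abs_of_pos ht]; linarith
      have hmem1 := hpR (y + t • e) (by linarith)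
      have e1 : p + (y + t • e) + η • v = Q + t • e := by rw [hQy]; abel
      have h1 := h.mono _ hmem1 η hη0.le (by rw [e1]; exact hsub (hDR _ hQD _ htR))
      rw [e1] at h1
      have h2 := h.abs_sub_le (Metric.mem_closedBall_self hR.le) hmem1
        (by rw [add_sub_cancel_left]; linarith)
      rw [add_sub_cancel_left, hfp] at h2
      have h3 := (abs_le.1 h2).1
      have h4 : 2 * C * ‖y + t • e‖ ≤ 2 * C * (2 * ρ) := by gcongr
      refine le_trans ?_ hρC
      rw [le_div_iff₀ hc]
      linarith
    have hlow : -(R / 32) ≤ η + τ := by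
      rcases le_or_gt 0 (η + τ) with hη0 | hη0
      · linarith
      have hmem1 := hpR y (by linarith)
      have e1 : Q + τ • v + (-(η + τ)) • v = p + y := by rw [hQy, neg_smul, add_smul]; abel
      have h1 := h.mono (Q + τ • v) (hsub (hDR _ hQD _ (hvR _ hτ))) (-(η + τ)) (by linarith)
        (by rw [e1]; exact hmem1)
      rw [e1] at h1
      have h2 := h.abs_sub_le (Metric.mem_closedBall_self hR.le) hmem1
        (by rw [add_sub_cancel_left]; linarith)
      rw [add_sub_cancel_left, hfp] at h2
      have h3 := (abs_le.1 h2).2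
      have h4 : 2 * C * ‖y‖ ≤ 2 * C * (2 * ρ) := by gcongr; linarith
      have h5 : -(η + τ) ≤ R / 32 := by
        refine le_trans ?_ hρC
        rw [le_div_iff₀ hc]
        linarith
      linarith
    have hη1 : |η| ≤ R / 16 := abs_le.2 ⟨by linarith [hτ.2], by linarith⟩
    linarith
  -- For `β ≤ 0` the inclusion `E - t e ⊆ E` already gives `f x ≤ 0`. For `β > 0`, a positive value
  -- of `f` at `x + β v` would leave the slightly smaller displacement `β - ε` admissible, beating
  -- the minimum.
  have hclaim : ∀ x ∈ D, f (x + t • e) ≤ 0 → f (x + (τ - κ * (N x - N Q)) • v) ≤ 0 := by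
    intro x hx hfx
    set β := τ - κ * (N x - N Q) with hβ
    have hxR : x ∈ Metric.ball p R := by simpa using hDR x hx 0 (by simpa using by positivity)
    have hβδ : β ≤ δ₀ := by
      have h1 : 0 ≤ κ * N x := mul_nonneg hκ0.le (dropInner_self_nonneg _)
      have h2 : β = τ + κ * N Q - κ * N x := by rw [hβ]; ring
      linarith
    have hβlow : -(R / 32) ≤ β := by
      have h1 : κ * N x ≤ κ * (n * R ^ 2) := by gcongr; exact hNR x hx
      have h2 : β = τ + κ * N Q - κ * N x := by rw [hβ]; ring
      have h3 : 0 ≤ κ * N Q := mul_nonneg hκ0.le hNQ0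
      linarith [hτ.1]
    have hβR : ‖β • v‖ ≤ R / 4 := by
      rw [hnv]; exact abs_le.2 ⟨by linarith, by linarith⟩
    rcases le_or_gt β 0 with hβ0 | hβ0
    · have h1 := h.nonpos_of_translate_nonpos (hE t ht.le) hxR (hDR x hx _ htR) hfx
      have e1 : x + β • v + (-β) • v = x := by rw [neg_smul]; abel
      have h2 := h.mono (x + β • v) (hsub (hDR x hx _ hβR)) (-β) (by linarith)
        (by rw [e1]; exact hsub hxR)
      rw [e1] at h2
      nlinarith
    · by_contra! hpos
      obtain ⟨ε, ⟨⟨-, h2⟩, hε⟩, (hε0 : 0 < ε)⟩ :=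
        (((h.eventually_pos_sub (hDR x hx _ hβR) hpos).and
          (mem_nhdsWithin_of_mem_nhds (Iio_mem_nhds hβ0))).and self_mem_nhdsWithin).exists
      replace hε : ε < β := hε
      have e1 : x + β • v - ε • v = x + (β - ε) • v := by rw [sub_smul β ε v, add_sub_assoc]
      rw [e1] at h2
      have h3 := hmin' x (β - ε) ⟨⟨hx, by linarith, by linarith⟩, hfx, h2.le⟩
      have h4 : β = τ + κ * N Q - κ * N x := by rw [hβ]; ring
      linarith
  have hQzero : f (Q + τ • v) = 0 := by
    have h1 := hclaim Q hQD hQ1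
    rw [sub_self, mul_zero, sub_zero] at h1
    exact le_antisymm h1 hQ2
  -- Otherwise `Q + ε v` also belongs to the translate, with the same `N`, and `hclaim` there
  -- contradicts strict growth of `f` from its zero `Q + τ v`.
  have hQzero' : f (Q + t • e) = 0 := by
    by_contra hne0
    have hneg : f (Q + t • e) < 0 := lt_of_le_of_ne hQ1 hne0
    obtain ⟨ε, ⟨h1, hε⟩, (hε0 : 0 < ε)⟩ :=
      (((h.eventually_neg_add (hDR Q hQD _ htR) hneg).and
        (mem_nhdsWithin_of_mem_nhds (Iio_mem_nhds (show (0 : ℝ) < R / 8 by positivity)))).and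
          self_mem_nhdsWithin).exists
    replace hε : ε < R / 8 := hε
    have hmemD : Q + ε • v ∈ D := by
      rw [hD, mem_closedBall_iff_norm]
      have e1 : Q + ε • v - p = (Q - p) + ε • v := by abel
      rw [e1]
      refine (norm_add_le _ _).trans ?_
      rw [hnv, abs_of_pos hε0]; linarith
    have e2 : Q + t • e + ε • v = Q + ε • v + t • e := by abel
    rw [e2] at h1
    have h2 := hclaim _ hmemD h1.le
    rw [hNv, sub_self, mul_zero, sub_zero] at h2
    have e3 : Q + ε • v + τ • v = Q + τ • v + ε • v := by abel
    have h3 := h.mono (Q + τ • v) (hsub (hDR _ hQD _ (hvR _ hτ))) ε hε0.le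
      (by rw [← e3]; exact hsub (hDR _ hmemD _ (hvR _ hτ)))
    rw [e3] at h2
    rw [hQzero] at h3
    nlinarith [mul_pos hc hε0]
  exact ⟨Q, τ, κ, hQp, hτ.1, hτ.2.trans hδ₀A, hκ0.le, hκA, hQzero', hQzero, hclaim⟩

/-! ### Comparing near and far parts -/

/-- The singular part of the kernel `|z|^{-a}`, supported in the ball of radius `r`. -/
def nearKernel {W : Type*} [Norm W] (a r : ℝ) (z : W) : ℝ := singKernel a z - farKernel a r z

/-- The linear form `z ↦ κ ⟨b, z⟩` built from the components orthogonal to the `i`-th axis. -/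
def dropForm {n : ℕ} (i : Fin (n + 1)) (κ : ℝ) (b : EuclideanSpace ℝ (Fin (n + 1))) :
    EuclideanSpace ℝ (Fin (n + 1)) →ₗ[ℝ] ℝ where
  toFun z := κ * dropInner i b z
  map_add' x y := by rw [dropInner_add_right, mul_add]
  map_smul' c x := by rw [dropInner_smul_right, RingHom.id_apply, smul_eq_mul]; ring

/-- The determinant is `1 + φ v = 1`. Such a shear removes the linear part of the paraboloid at the
touching point without changing integrals. -/
theorem measurePreserving_transvection {n : ℕ}
    {φ : EuclideanSpace ℝ (Fin (n + 1)) →ₗ[ℝ] ℝ} {v : EuclideanSpace ℝ (Fin (n + 1))}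
    (h : φ v = 0) : MeasurePreserving (LinearMap.transvection φ v) := by
  have hdet : LinearMap.det (LinearMap.transvection φ v) = 1 := by
    rw [LinearMap.transvection.det, h, add_zero]
  refine ⟨(LinearMap.continuous_of_finiteDimensional _).measurable, ?_⟩
  rw [Measure.map_linearMap_addHaar_eq_smul_addHaar volume (by rw [hdet]; exact one_ne_zero), hdet]
  simp

section Shear

variable {n : ℕ} {E : Set (EuclideanSpace ℝ (Fin (n + 1)))} {a r : ℝ}

theorem nearKernel_eq_zero {z : EuclideanSpace ℝ (Fin (n + 1))} (hz : r ≤ ‖z‖) :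
    nearKernel a r z = 0 := by
  rw [nearKernel, farKernel_eq_singKernel hz, sub_self]

theorem nearKernel_nonneg (ha : 0 ≤ a) {z : EuclideanSpace ℝ (Fin (n + 1))} (hz : z ≠ 0) :
    0 ≤ nearKernel a r z := sub_nonneg.2 (farKernel_le_singKernel ha hz)

theorem nearKernel_le (z : EuclideanSpace ℝ (Fin (n + 1))) :
    nearKernel a r z ≤ singKernel a z := sub_le_self _ (farKernel_nonneg _ _ _)

theorem measurable_nearKernel (hr : 0 < r) :
    Measurable (nearKernel a r : EuclideanSpace ℝ (Fin (n + 1)) → ℝ) :=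
  (measurable_singKernel a).sub (continuous_farKernel hr).measurable

theorem integrable_symmIndicator_mul_singKernel (hE : NullMeasurableSet E)
    {q : EuclideanSpace ℝ (Fin (n + 1))} {M : ℝ}
    (h : ∫⁻ z, ENNReal.ofReal (|symmIndicator E q z| * singKernel a z) ≤ ENNReal.ofReal M) :
    Integrable fun z => symmIndicator E q z * singKernel a z := by
  refine ⟨(aestronglyMeasurable_symmIndicator hE q).mul
    (measurable_singKernel a).aestronglyMeasurable, lt_of_le_of_lt (lintegral_mono fun z => ?_)
    (h.trans_lt ENNReal.ofReal_lt_top)⟩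
  rw [← ofReal_norm, norm_mul, Real.norm_eq_abs, Real.norm_of_nonneg (singKernel_nonneg a z)]

theorem integral_abs_symmIndicator_mul_singKernel_le (hE : NullMeasurableSet E)
    {q : EuclideanSpace ℝ (Fin (n + 1))} {M : ℝ} (hM : 0 ≤ M)
    (h : ∫⁻ z, ENNReal.ofReal (|symmIndicator E q z| * singKernel a z) ≤ ENNReal.ofReal M) :
    ∫ z, |symmIndicator E q z| * singKernel a z ≤ M := by
  rw [integral_eq_lintegral_of_nonneg_ae
    (ae_of_all _ fun z => mul_nonneg (abs_nonneg _) (singKernel_nonneg a z))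
    ((aestronglyMeasurable_symmIndicator hE q).norm.mul
      (measurable_singKernel a).aestronglyMeasurable)]
  exact ENNReal.toReal_le_of_le_ofReal hM h

theorem ae_ne_zero : ∀ᵐ z : EuclideanSpace ℝ (Fin (n + 1)), z ≠ 0 :=
  compl_mem_ae_iff.2 (measure_singleton 0)

/-- The singular part of the integral changes little under a volume preserving linear
transformation `T` which is close to the identity. -/
theorem abs_integral_symmIndicator_comp_sub_le (ha : 0 < a) (ha' : (n : ℝ) + 1 < a) (hr : 0 < r)
    (hE : NullMeasurableSet E) {q : EuclideanSpace ℝ (Fin (n + 1))} {M C ε : ℝ} (hM : 0 ≤ M)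
    (hq : ∫⁻ z, ENNReal.ofReal (|symmIndicator E q z| * singKernel a z) ≤ ENNReal.ofReal M)
    (hC : 0 ≤ C) (hCa : ∀ u v δ : ℝ, 0 < u → δ ≤ 1 / 2 → |v - u| ≤ δ * u →
      |v ^ (-a) - u ^ (-a)| ≤ C * δ * u ^ (-a))
    (hε0 : 0 ≤ ε) (hε : ε ≤ 1 / 2)
    {T : EuclideanSpace ℝ (Fin (n + 1)) → EuclideanSpace ℝ (Fin (n + 1))}
    (hT : MeasurePreserving T) (hTemb : MeasurableEmbedding T)
    (hTε : ∀ z, ‖z - T z‖ ≤ ε * ‖T z‖) :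
    Integrable (fun z => symmIndicator E q (T z) * nearKernel a r z) ∧
    |(∫ z, symmIndicator E q (T z) * nearKernel a r z) -
      ∫ z, symmIndicator E q z * nearKernel a r z|
      ≤ 2 * C * ε * M := by
  have hint := integrable_symmIndicator_mul_singKernel hE hq
  have hintn : Integrable fun z => symmIndicator E q z * nearKernel a r z := by
    have := hint.sub (integrable_symmIndicator_mul hE q (integrable_farKernel ha' hr))
    refine this.congr (ae_of_all _ fun z => ?_)
    simp only [Pi.sub_apply, nearKernel]; ring
  have hintT : Integrable fun z => symmIndicator E q (T z) * nearKernel a r (T z) :=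
    hT.integrable_comp_of_integrable hintn
  have habs : Integrable fun z => |symmIndicator E q (T z)| * singKernel a (T z) := by
    have h1 := hT.integrable_comp_of_integrable hint.norm
    refine h1.congr (ae_of_all _ fun z => ?_)
    simp only [Function.comp, norm_mul, Real.norm_eq_abs, abs_of_nonneg (singKernel_nonneg a _)]
  have hT0 : ∀ᵐ z, T z ≠ 0 := hT.quasiMeasurePreserving.ae ae_ne_zero
  have hpt : ∀ᵐ z, ‖symmIndicator E q (T z) * nearKernel a r z -
      symmIndicator E q (T z) * nearKernel a r (T z)‖ ≤
        2 * C * ε * (|symmIndicator E q (T z)| * singKernel a (T z)) := by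
    filter_upwards [hT0] with z hz
    have hTz : 0 < ‖T z‖ := norm_pos_iff.2 hz
    have h0 : |‖z‖ - ‖T z‖| ≤ ε * ‖T z‖ := (abs_norm_sub_norm_le _ _).trans (hTε z)
    have h1 := hCa ‖T z‖ ‖z‖ ε hTz hε h0
    have h2 := hCa (max ‖T z‖ r) (max ‖z‖ r) ε (lt_max_of_lt_right hr) hε (by
      refine (abs_max_sub_max_le_abs _ _ _).trans (h0.trans ?_)
      gcongr
      exact le_max_left _ _)
    have h3 : farKernel a r (T z) ≤ singKernel a (T z) := farKernel_le_singKernel ha.le hz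
    -- The factor `2` counts the variations of the singular and of the far kernel, both relative to
    -- `singKernel a (T z)`.
    have h4 : |nearKernel a r z - nearKernel a r (T z)| ≤ 2 * C * ε * singKernel a (T z) := by
      have e1 : nearKernel a r z - nearKernel a r (T z) =
          (singKernel a z - singKernel a (T z)) - (farKernel a r z - farKernel a r (T z)) := by
        simp only [nearKernel]; ring
      rw [e1]
      have h5 : |singKernel a z - singKernel a (T z)| ≤ C * ε * singKernel a (T z) := h1
      have h6 : |farKernel a r z - farKernel a r (T z)| ≤ C * ε * farKernel a r (T z) := h2
      have h7 : C * ε * farKernel a r (T z) ≤ C * ε * singKernel a (T z) := by gcongr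
      refine (abs_sub _ _).trans ?_
      linarith
    rw [← mul_sub, norm_mul, Real.norm_eq_abs, Real.norm_eq_abs]
    calc |symmIndicator E q (T z)| * |nearKernel a r z - nearKernel a r (T z)|
        ≤ |symmIndicator E q (T z)| * (2 * C * ε * singKernel a (T z)) := by gcongr
      _ = _ := by ring
  have hdiff : Integrable fun z => symmIndicator E q (T z) * nearKernel a r z -
      symmIndicator E q (T z) * nearKernel a r (T z) := by
    refine (habs.const_mul (2 * C * ε)).mono' ?_ hpt
    exact (((aestronglyMeasurable_symmIndicator hE q).comp_measurePreserving hT).mul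
      (measurable_nearKernel hr).aestronglyMeasurable).sub hintT.aestronglyMeasurable
  have hintT' : Integrable fun z => symmIndicator E q (T z) * nearKernel a r z := by
    refine (hdiff.add hintT).congr (ae_of_all _ fun z => ?_)
    simp
  refine ⟨hintT', ?_⟩
  have e2 : ∫ z, symmIndicator E q z * nearKernel a r z =
      ∫ z, symmIndicator E q (T z) * nearKernel a r (T z) :=
    (hT.integral_comp hTemb fun z => symmIndicator E q z * nearKernel a r z).symm
  rw [e2, ← integral_sub hintT' hintT]
  calc |∫ z, (symmIndicator E q (T z) * nearKernel a r z -
          symmIndicator E q (T z) * nearKernel a r (T z))|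
      ≤ ∫ z, 2 * C * ε * (|symmIndicator E q (T z)| * singKernel a (T z)) :=
        norm_integral_le_of_norm_le (habs.const_mul _) hpt
    _ = 2 * C * ε * ∫ z, |symmIndicator E q z| * singKernel a z := by
        rw [integral_const_mul,
          hT.integral_comp hTemb fun z => |symmIndicator E q z| * singKernel a z]
    _ ≤ 2 * C * ε * M := by
        gcongr
        exact integral_abs_symmIndicator_mul_singKernel_le hE hM hq

/-- The far part of the integral depends in a Lipschitz way on the base point. -/
theorem abs_integral_signedIndicator_translate_sub_le (ha' : (n : ℝ) + 1 < a) (hr : 0 < r)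
    (hE : NullMeasurableSet E) (q w : EuclideanSpace ℝ (Fin (n + 1))) {C : ℝ}
    (hCa : ∀ u v δ : ℝ, 0 < u → δ ≤ 1 / 2 → |v - u| ≤ δ * u →
      |v ^ (-a) - u ^ (-a)| ≤ C * δ * u ^ (-a))
    (hw : ‖w‖ / r ≤ 1 / 2) :
    |(∫ z, signedIndicator E (q + w + z) * farKernel a r z) -
      ∫ z, signedIndicator E (q + z) * farKernel a r z| ≤
        C * (‖w‖ / r) * ∫ z : EuclideanSpace ℝ (Fin (n + 1)), farKernel a r z := by
  have hk := integrable_farKernel (n := n) ha' hr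
  have hk' : Integrable fun z : EuclideanSpace ℝ (Fin (n + 1)) => farKernel a r (z - w) :=
    hk.comp_sub_right w
  -- The translation is moved from the set, which is rough, to the kernel, which has small relative
  -- variation.
  have e1 : ∫ z, signedIndicator E (q + w + z) * farKernel a r z =
      ∫ z, signedIndicator E (q + z) * farKernel a r (z - w) := by
    rw [← integral_sub_right_eq_self _ w]
    congr 1 with z
    rw [add_add_sub_cancel]
  rw [e1, ← integral_sub (integrable_signedIndicator_mul hE q hk')
    (integrable_signedIndicator_mul hE q hk), ← integral_const_mul,
    ← Real.norm_eq_abs]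
  refine norm_integral_le_of_norm_le (hk.const_mul _) (ae_of_all _ fun z => ?_)
  rw [← mul_sub, norm_mul, Real.norm_eq_abs, abs_signedIndicator, one_mul, Real.norm_eq_abs]
  refine hCa (max ‖z‖ r) (max ‖z - w‖ r) (‖w‖ / r) (lt_max_of_lt_right hr) hw ?_
  refine (abs_max_sub_max_le_abs _ _ _).trans ((abs_norm_sub_norm_le _ _).trans ?_)
  rw [sub_sub_cancel_left, norm_neg, div_mul_eq_mul_div, le_div_iff₀ hr]
  gcongr
  exact le_max_right _ _

/-- Gain from the strict inclusion of the translate. -/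
theorem le_integral_signedIndicator_translate_sub (ha : 0 ≤ a) (ha' : (n : ℝ) + 1 < a) (hr : 0 < r)
    (hE : NullMeasurableSet E) (P w p : EuclideanSpace ℝ (Fin (n + 1)))
    (hmono : ∀ y, y + w ∈ E → y ∈ E) {M d : ℝ} (hd : ‖P - p‖ ≤ d) (hrM : r ≤ M + d) :
    2 * (M + d) ^ (-a) * volume.real ({x | x ∈ E ∧ x + w ∉ E} ∩ Metric.ball p M) ≤
      (∫ z, signedIndicator E (P + w + z) * farKernel a r z) -
        ∫ z, signedIndicator E (P + z) * farKernel a r z := by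
  have hk := integrable_farKernel (n := n) ha' hr
  have hi1 := integrable_signedIndicator_mul hE (P + w) hk
  have hi2 := integrable_signedIndicator_mul hE P hk
  set S := {x | x ∈ E ∧ x + w ∉ E} ∩ Metric.ball p M with hS
  have hSm : NullMeasurableSet S := by
    have h1 : NullMeasurableSet ((fun x => x + w) ⁻¹' E) :=
      hE.preimage (measurePreserving_add_right volume w).quasiMeasurePreserving
    exact (hE.inter h1.compl).inter Metric.isOpen_ball.measurableSet.nullMeasurableSet
  set S' := (fun z => P + z) ⁻¹' S with hS'
  have hmp := measurePreserving_add_left (volume : Measure (EuclideanSpace ℝ (Fin (n + 1)))) P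
  have hS'm : NullMeasurableSet S' := hSm.preimage hmp.quasiMeasurePreserving
  have hvol : volume.real S' = volume.real S := by
    rw [measureReal_def, measureReal_def, hS', hmp.measure_preimage hSm]
  have hfin : volume S' ≠ ∞ := by
    rw [hS', hmp.measure_preimage hSm]
    exact ((measure_mono inter_subset_right).trans_lt measure_ball_lt_top).ne
  rw [← integral_sub hi1 hi2, ← hvol]
  have e1 : 2 * (M + d) ^ (-a) * volume.real S' =
      ∫ z, S'.indicator (fun _ => 2 * (M + d) ^ (-a)) z := by
    rw [integral_indicator₀ hS'm, setIntegral_const, smul_eq_mul, mul_comm]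
  rw [e1]
  refine integral_mono ?_ (hi1.sub hi2) fun z => ?_
  · exact (integrableOn_const hfin).integrable_indicator₀ hS'm
  · have hk0 := farKernel_nonneg a r z
    have ecomm : P + w + z = P + z + w := by abel
    -- On `S'` the signed indicator jumps from `-1` to `1` and the kernel is at least `(M + d) ^
    -- (-a)`; elsewhere invariance of `E` makes the difference nonnegative.
    by_cases hz : z ∈ S'
    · rw [indicator_of_mem hz]
      obtain ⟨⟨h1, h2⟩, h3⟩ : (P + z ∈ E ∧ P + z + w ∉ E) ∧ P + z ∈ Metric.ball p M := hz
      beta_reduce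
      rw [ecomm, signedIndicator_of_mem h1, signedIndicator_of_notMem h2]
      have h4 : ‖z‖ ≤ M + d := by
        rw [mem_ball_iff_norm] at h3
        have e2 : z = (P + z - p) - (P - p) := by abel
        rw [e2]
        exact (norm_sub_le _ _).trans (add_le_add h3.le hd)
      have h5 : (M + d) ^ (-a) ≤ farKernel a r z :=
        Real.rpow_le_rpow_of_nonpos (lt_max_of_lt_right hr) (max_le h4 hrM) (neg_nonpos.2 ha)
      linarith
    · rw [indicator_of_notMem hz]
      beta_reduce
      rw [← sub_mul]
      refine mul_nonneg ?_ hk0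
      rw [ecomm]
      by_cases h1 : P + z ∈ E
      · rw [signedIndicator_of_mem h1]
        linarith [(abs_le.1 (abs_signedIndicator (E := E) (P + z + w)).le).1]
      · rw [signedIndicator_of_notMem h1, signedIndicator_of_notMem fun h => h1 (hmono _ h)]
        simp

end Shear

/-- If the perturbed translate touches `E` from inside at `P`, then the singular part of the
nonlocal mean curvature of the (sheared) translate is almost above the one of `E`. -/
theorem IsLocalChart.le_integral_symmIndicator_shear {n : ℕ} {a r w : ℝ}
    {E : Set (EuclideanSpace ℝ (Fin (n + 1)))}
    {p v q P : EuclideanSpace ℝ (Fin (n + 1))} {i : Fin (n + 1)} {θ : ℝ} (hθ : θ * θ = 1)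
    (hv : v = θ • EuclideanSpace.single i (1 : ℝ))
    {f : EuclideanSpace ℝ (Fin (n + 1)) → ℝ}
    {G : EuclideanSpace ℝ (Fin (n + 1)) → EuclideanSpace ℝ (Fin (n + 1)) →L[ℝ] ℝ} {R c C : ℝ}
    (h : IsLocalChart E p v f G R c C) (ha : 0 < a) {M : ℝ} (hM : 0 ≤ M)
    (hlayer : ∀ (i : Fin (n + 1)) (A : Set (EuclideanSpace ℝ (Fin (n + 1)))) (w : ℝ),
      MeasurableSet A → A ⊆ Metric.closedBall 0 r → 0 ≤ w →
      (∀ z₁ ∈ A, ∀ z₂ ∈ A, dropCoord i z₁ = dropCoord i z₂ →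
        |z₁ i - z₂ i| ≤ w * ‖dropCoord i z₁‖ ^ 2) →
      ∫⁻ z in A, ENNReal.ofReal (‖z‖ ^ (-a)) ≤ ENNReal.ofReal (w * M))
    (hw : 0 ≤ w) (hP : ‖P - p‖ + r + w * n * r ^ 2 ≤ R)
    {T : EuclideanSpace ℝ (Fin (n + 1)) → EuclideanSpace ℝ (Fin (n + 1))}
    (hTneg : ∀ z, T (-z) = -T z)
    (hTint : Integrable fun z => symmIndicator E q (T z) * nearKernel a r z)
    (hPint : Integrable fun z => symmIndicator E P z * nearKernel a r z)
    (htouch : ∀ z, ‖z‖ ≤ r → q + T z ∈ E → f (P + z - (w * dropInner i z z) • v) ≤ 0) :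
    (∫ z, symmIndicator E P z * nearKernel a r z) - 4 * (w * n * M) ≤
      ∫ z, symmIndicator E q (T z) * nearKernel a r z := by
  have hvn : ‖v‖ = 1 := by rw [hv]; exact norm_smul_single hθ
  have hmem : ∀ z : EuclideanSpace ℝ (Fin (n + 1)), ‖z‖ ≤ r → P + z ∈ Metric.closedBall p R := by
    intro z hz
    have h1 : 0 ≤ w * n * r ^ 2 := by positivity
    have e1 : P + z - p = (P - p) + z := by abel
    rw [mem_closedBall_iff_norm, e1]
    linarith [norm_add_le (P - p) z]
  have hsq : ∀ z : EuclideanSpace ℝ (Fin (n + 1)), ‖z‖ ≤ r →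
      w * dropInner i z z ≤ w * n * r ^ 2 := by
    intro z hz
    have h1 := (le_abs_self _).trans (abs_dropInner_le_norm (i := i) z z)
    rw [mul_assoc]
    gcongr
    refine h1.trans ?_
    rw [← sq]
    gcongr
  have hsq0 : ∀ z : EuclideanSpace ℝ (Fin (n + 1)), 0 ≤ w * dropInner i z z :=
    fun z => mul_nonneg hw (dropInner_self_nonneg z)
  have hmem' : ∀ z : EuclideanSpace ℝ (Fin (n + 1)), ‖z‖ ≤ r → ∀ η, 0 ≤ η → η ≤ w * n * r ^ 2 →
      P + z - η • v ∈ Metric.closedBall p R := by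
    intro z hz η hη hη'
    have e1 : P + z - η • v - p = (P - p) + z - η • v := by abel
    have h2 : ‖η • v‖ = η := by rw [norm_smul, hvn, mul_one, Real.norm_of_nonneg hη]
    rw [mem_closedBall_iff_norm, e1]
    linarith [norm_add_le (P - p) z, norm_sub_le (P - p + z) (η • v)]
  -- Within the ball, `L` contains every `z` for which `q + T z ∈ E` but `P + z ∉ E`. Its thickness
  -- along `v` is at most `w * dropInner i z z`.
  set L := {z ∈ Metric.closedBall (0 : EuclideanSpace ℝ (Fin (n + 1))) r |
    f (P + z - (w * dropInner i z z) • v) ≤ 0 ∧ 0 ≤ f (P + z)} with hL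
  have hdcont : Continuous fun z : EuclideanSpace ℝ (Fin (n + 1)) => dropInner i z z := by
    simpa using continuous_dropInner_sub (i := i) (0 : EuclideanSpace ℝ (Fin (n + 1)))
  have hLm : MeasurableSet L := by
    have hc1 : ContinuousOn (fun z => f (P + z - (w * dropInner i z z) • v))
        (Metric.closedBall (0 : EuclideanSpace ℝ (Fin (n + 1))) r) := by
      refine h.continuousOn.comp (by fun_prop) fun z hz => ?_
      have hz' : ‖z‖ ≤ r := by simpa using hz
      exact hmem' z hz' _ (hsq0 z) (hsq z hz')
    have hc2 : ContinuousOn (fun z => f (P + z))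
        (Metric.closedBall (0 : EuclideanSpace ℝ (Fin (n + 1))) r) :=
      h.continuousOn.comp (by fun_prop) fun z hz => hmem z (by simpa using hz)
    have hcl := (hc1.preimage_isClosed_of_isClosed Metric.isClosed_closedBall
      isClosed_Iic (t := Iic 0)).inter
      (hc2.preimage_isClosed_of_isClosed Metric.isClosed_closedBall isClosed_Ici (t := Ici 0))
    convert hcl.measurableSet using 1
    ext z
    simp only [hL, mem_ofPred_eq, mem_inter_iff, mem_preimage, mem_Iic, mem_Ici]
    tauto
  have hsec : ∀ z ∈ L, ∀ δ : ℝ, 0 ≤ δ → z + δ • (θ • EuclideanSpace.single i (1 : ℝ)) ∈ L →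
      δ ≤ w * n * ‖dropCoord i z‖ ^ 2 := by
    rw [← hv]
    rintro z ⟨hz1, -, hz3⟩ δ hδ ⟨hz1', hz2', -⟩
    have hzr : ‖z‖ ≤ r := by simpa using hz1
    have hzr' : ‖z + δ • v‖ ≤ r := by simpa using hz1'
    have e1 : dropInner i (z + δ • v) (z + δ • v) = dropInner i z z := by
      rw [dropInner_add_self, hv, smul_smul, dropInner_single_right, dropInner_single_right]
      ring
    rw [e1] at hz2'
    have h1 : w * dropInner i z z ≤ w * n * ‖dropCoord i z‖ ^ 2 := by
      rw [mul_assoc, sq]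
      gcongr
      exact (le_abs_self _).trans (abs_dropInner_le z z)
    refine le_trans ?_ h1
    by_contra! hlt
    have e2 : P + (z + δ • v) - (w * dropInner i z z) • v =
        P + z + (δ - w * dropInner i z z) • v := by
      rw [sub_smul δ _ v]; abel
    have h2 := h.mono (P + z) (hmem z hzr) (δ - w * dropInner i z z) (by linarith)
      (by rw [← e2]; exact hmem' _ hzr' _ (hsq0 z) (hsq z hzr))
    rw [e2] at hz2'
    nlinarith [mul_pos h.c_pos (sub_pos.2 hlt)]
  have hLint := hlayer i L (w * n) hLm (fun z hz => hz.1) (by positivity)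
    (section_diam_le (w := fun y => w * n * ‖y‖ ^ 2) hθ hsec)
  set g := L.indicator (singKernel a) with hg
  have hgm : Measurable g := (measurable_singKernel a).indicator hLm
  have hg0 : ∀ z, 0 ≤ g z := fun z => indicator_nonneg (fun z _ => singKernel_nonneg a z) z
  have hglint : ∫⁻ z, ENNReal.ofReal (g z) ≤ ENNReal.ofReal (w * n * M) := by
    refine le_trans (le_of_eq ?_) hLint
    rw [← lintegral_indicator hLm]
    congr 1 with z
    by_cases hz : z ∈ L
    · rw [hg, indicator_of_mem hz, indicator_of_mem hz]; rfl
    · rw [hg, indicator_of_notMem hz, indicator_of_notMem hz, ENNReal.ofReal_zero]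
  have hgi : Integrable g := by
    refine ⟨hgm.aestronglyMeasurable, lt_of_le_of_lt (lintegral_mono fun z => ?_)
      (hglint.trans_lt ENNReal.ofReal_lt_top)⟩
    rw [← ofReal_norm, Real.norm_of_nonneg (hg0 z)]
  have hgint : ∫ z, g z ≤ w * n * M := by
    rw [integral_eq_lintegral_of_nonneg_ae (ae_of_all _ hg0) hgm.aestronglyMeasurable]
    exact ENNReal.toReal_le_of_le_ofReal (by positivity) hglint
  have hone : ∀ z, ‖z‖ ≤ r →
      signedIndicator E (P + z) - 2 * L.indicator (fun _ => (1 : ℝ)) z ≤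
        signedIndicator E (q + T z) := by
    intro z hz
    have h1 := abs_le.1 (abs_signedIndicator (E := E) (P + z)).le
    have h2 := abs_le.1 (abs_signedIndicator (E := E) (q + T z)).le
    by_cases hzL : z ∈ L
    · rw [indicator_of_mem hzL]; linarith
    rw [indicator_of_notMem hzL]
    by_cases hqz : q + T z ∈ E
    · have hPz : P + z ∈ E := by
        by_contra hPz
        refine hzL ⟨by simpa using hz, htouch z hz hqz, ?_⟩
        by_contra! hneg
        exact hPz (h.mem_of_neg _ (hmem z hz) hneg)
      rw [signedIndicator_of_mem hPz, signedIndicator_of_mem hqz]; norm_num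
    · rw [signedIndicator_of_notMem hqz]; linarith
  -- Each failure of inclusion costs `2`, and symmetrization counts failures at `z` and `-z`; hence
  -- the total `4 ∫ g`.
  have hpt : ∀ᵐ z, symmIndicator E P z * nearKernel a r z - 2 * (g z + g (-z)) ≤
      symmIndicator E q (T z) * nearKernel a r z := by
    filter_upwards [ae_ne_zero] with z hz0
    have hk0 := nearKernel_nonneg (r := r) ha.le hz0
    have hk1 := nearKernel_le (a := a) (r := r) z
    rcases le_or_gt r ‖z‖ with hz | hz
    · rw [nearKernel_eq_zero hz]
      linarith [hg0 z, hg0 (-z)]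
    have h1 := hone z hz.le
    have h2 := hone (-z) (by rw [norm_neg]; exact hz.le)
    rw [hTneg, ← sub_eq_add_neg, ← sub_eq_add_neg] at h2
    have h3 : ∀ y, singKernel a y = singKernel a z →
        L.indicator (fun _ => (1 : ℝ)) y * nearKernel a r z ≤ g y := by
      intro y hy
      by_cases hyL : y ∈ L
      · rw [hg, indicator_of_mem hyL, indicator_of_mem hyL, one_mul, hy]; exact hk1
      · rw [hg, indicator_of_notMem hyL, indicator_of_notMem hyL, zero_mul]
    have h4 := h3 z rfl
    have h5 := h3 (-z) (singKernel_neg a z)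
    simp only [symmIndicator]
    have h6 := mul_le_mul_of_nonneg_right (add_le_add h1 h2) hk0
    linarith
  have hgg : Integrable fun z => 2 * (g z + g (-z)) := (hgi.add hgi.comp_neg).const_mul 2
  have hi : Integrable fun z => symmIndicator E P z * nearKernel a r z - 2 * (g z + g (-z)) :=
    hPint.sub hgg
  have h1 := integral_mono_ae hi hTint hpt
  have h2 : ∫ z, (symmIndicator E P z * nearKernel a r z - 2 * (g z + g (-z))) =
      (∫ z, symmIndicator E P z * nearKernel a r z) - 4 * ∫ z, g z := by
    rw [integral_sub hPint hgg, integral_const_mul,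
      integral_add hgi hgi.comp_neg, integral_neg_eq_self g volume]
    ring
  rw [h2] at h1
  linarith

/-! ### The quadratic upper bound -/

set_option maxHeartbeats 1000000 in
/-- If `e` is tangent at `p` to the boundary of a set `E` of vanishing nonlocal mean curvature which
is invariant under translations by `-t e`, then `E - t e` locally exhausts `E` up to measure
`O(t²)`. -/
theorem IsLocalChart.exists_volume_diff_le {n : ℕ} (hn : 0 < n) {s : ℝ} (hs0 : 0 < s)
    (hs1 : s < 1 / 2) {E : Set (EuclideanSpace ℝ (Fin (n + 1)))} (hEm : NullMeasurableSet E)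
    (hH : ∀ x ∈ frontier E, HasNonlocalMeanCurvature s E x 0)
    {p v e : EuclideanSpace ℝ (Fin (n + 1))} {i : Fin (n + 1)} {θ : ℝ} (hθ : θ * θ = 1)
    (hv : v = θ • EuclideanSpace.single i (1 : ℝ))
    {f : EuclideanSpace ℝ (Fin (n + 1)) → ℝ}
    {G : EuclideanSpace ℝ (Fin (n + 1)) → EuclideanSpace ℝ (Fin (n + 1)) →L[ℝ] ℝ} {R c C : ℝ}
    (h : IsLocalChart E p v f G R c C) (hfp : f p = 0) (he : ‖e‖ = 1) (hGe : G p e = 0)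
    (hE : ∀ t : ℝ, 0 ≤ t → ∀ y, y + t • e ∈ E → y ∈ E) {M : ℝ} (hM : 0 < M) :
    ∃ t₀ B : ℝ, 0 < t₀ ∧ ∀ t : ℝ, 0 < t → t ≤ t₀ →
      volume.real ({x | x ∈ E ∧ x + t • e ∉ E} ∩ Metric.ball p M) ≤ B * t ^ 2 := by
  have hR := h.R_pos
  set a : ℝ := (n + 1 : ℕ) + 2 * s with ha
  have ha1 : (n : ℝ) + 1 < a := by rw [ha]; push_cast; linarith
  have ha2 : a < n + 2 := by rw [ha]; push_cast; linarith
  have ha0 : 0 < a := by have := n.cast_nonneg (α := ℝ); linarith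
  have hvn : ‖v‖ = 1 := by rw [hv]; exact norm_smul_single hθ
  have hnv : ∀ δ : ℝ, ‖δ • v‖ = |δ| := fun δ => by rw [norm_smul, hvn, mul_one, Real.norm_eq_abs]
  obtain ⟨Cp, hCp, hpow⟩ := exists_abs_rpow_neg_sub_le ha0
  obtain ⟨MS, hMS, hsym⟩ : ∃ M : ℝ, 0 ≤ M ∧ ∀ q ∈ Metric.closedBall p (R / 2), f q = 0 →
      ∫⁻ z, ENNReal.ofReal (|symmIndicator E q z| * singKernel a z) ≤ ENNReal.ofReal M := by
    rw [hv] at h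
    exact h.exists_lintegral_symmIndicator_le hn ha1 ha2 hθ
  obtain ⟨t₁, A, ht₁, hA, htouch⟩ := h.exists_touching hθ hv hfp he hGe hE
  set r := min (R / 16) M with hr
  have hr0 : 0 < r := by positivity
  have hrR : r ≤ R / 16 := min_le_left _ _
  have hrM : r ≤ M := min_le_right _ _
  obtain ⟨ML, hML, hlayer⟩ := exists_setLIntegral_kernel_layer_le hn ha0 ha2 r
  set K := ∫ z : EuclideanSpace ℝ (Fin (n + 1)), farKernel a r z with hK
  have hK0 : 0 ≤ K := integral_nonneg (farKernel_nonneg a r)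
  set m := (M + R) ^ (-a) with hm
  have hm0 : 0 < m := Real.rpow_pos_of_pos (by linarith) _
  -- smallness of `t`
  set Z := 1 + 1 / R + 1 / r + n * R + n * r ^ 2 / R with hZ
  have hZ0 : 0 < Z := by positivity
  obtain ⟨t₀, ht₀, ht₀1, ht₀R, ht₀A⟩ : ∃ t₀ : ℝ, 0 < t₀ ∧ t₀ ≤ t₁ ∧ t₀ ≤ min 1 (R / 16) ∧
      A * Z * t₀ ≤ 1 / 16 := by
    refine ⟨min (min t₁ (min 1 (R / 16))) (1 / (16 * (A * Z + 1))), by positivity,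
      (min_le_left _ _).trans (min_le_left _ _), (min_le_left _ _).trans (min_le_right _ _), ?_⟩
    have h1 : min (min t₁ (min 1 (R / 16))) (1 / (16 * (A * Z + 1))) ≤ 1 / (16 * (A * Z + 1)) :=
      min_le_right _ _
    have h2 : 0 ≤ min (min t₁ (min 1 (R / 16))) (1 / (16 * (A * Z + 1))) := by positivity
    rw [le_div_iff₀ (by positivity)] at h1
    nlinarith
  refine ⟨t₀, (Cp * n * R * MS + 4 * n * ML + 2 * Cp / r * K) * A / (4 * m), ht₀,
    fun t ht htt₀ => ?_⟩
  obtain ⟨Q, τ, κ, hQp, hτ0, hτA, hκ0, hκA, hfQ, hfP, htouch'⟩ := htouch t ht (htt₀.trans ht₀1)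
  have ht1 : t ≤ 1 := htt₀.trans (ht₀R.trans (min_le_left _ _))
  have htR : t ≤ R / 16 := htt₀.trans (ht₀R.trans (min_le_right _ _))
  have ht2 : t ^ 2 ≤ t₀ := by nlinarith
  have hAZ : A * t ^ 2 * Z ≤ 1 / 16 := by
    calc A * t ^ 2 * Z = A * Z * t ^ 2 := by ring
      _ ≤ A * Z * t₀ := by gcongr
      _ ≤ 1 / 16 := ht₀A
  have hsmall : ∀ x y : ℝ, 0 ≤ y → y ≤ Z → x ≤ A * t ^ 2 → x * y ≤ 1 / 16 := by
    intro x y hy hyZ hx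
    have h1 : x * y ≤ A * t ^ 2 * y := by gcongr
    have h2 : A * t ^ 2 * y ≤ A * t ^ 2 * Z := by gcongr
    linarith
  have hnR : 0 ≤ (n : ℝ) * R := by positivity
  have hnr : 0 ≤ (n : ℝ) * r ^ 2 / R := by positivity
  have h1R : 0 ≤ 1 / R := by positivity
  have h1r : 0 ≤ 1 / r := by positivity
  have hτR : τ ≤ R / 16 := by
    have := hsmall τ (1 / R) h1R (by rw [hZ]; linarith) hτA
    rw [mul_one_div, div_le_iff₀ hR] at this
    linarith
  have hτr : τ / r ≤ 1 / 2 := by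
    have := hsmall τ (1 / r) h1r (by rw [hZ]; linarith) hτA
    rw [mul_one_div] at this
    linarith
  have hκn : κ * (n * R) ≤ 1 / 2 := by
    have := hsmall κ (n * R) hnR (by rw [hZ]; linarith) hκA
    linarith
  have hκr : κ * n * r ^ 2 ≤ R / 16 := by
    have := hsmall κ (n * r ^ 2 / R) hnr (by rw [hZ]; linarith) hκA
    rw [← mul_div_assoc, div_le_iff₀ hR] at this
    linarith
  -- the two touching points
  set P := Q + τ • v with hP
  set q := Q + t • e with hq
  have hPp : ‖P - p‖ ≤ R / 4 := by
    have e1 : P - p = (Q - p) + τ • v := by rw [hP]; abel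
    rw [e1]
    refine (norm_add_le _ _).trans ?_
    rw [hnv, abs_of_nonneg hτ0]; linarith
  have hqp : ‖q - p‖ ≤ R / 4 := by
    have e1 : q - p = (Q - p) + t • e := by rw [hq]; abel
    rw [e1]
    refine (norm_add_le _ _).trans ?_
    rw [norm_smul, he, mul_one, Real.norm_of_nonneg ht.le]; linarith
  have hzero : ∀ x, ‖x - p‖ ≤ R / 4 → f x = 0 →
      (∫⁻ z, ENNReal.ofReal (|symmIndicator E x z| * singKernel a z) ≤ ENNReal.ofReal MS) ∧
      (Integrable fun z => symmIndicator E x z * nearKernel a r z) ∧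
      (∫ z, symmIndicator E x z * nearKernel a r z) +
        2 * (∫ z, signedIndicator E (x + z) * farKernel a r z) = 0 := by
    intro x hx hfx
    have hb := hsym x (by rw [mem_closedBall_iff_norm]; linarith) hfx
    have hint := integrable_symmIndicator_mul_singKernel hEm hb
    have hfr := h.mem_frontier (x := x) (by rw [mem_ball_iff_norm]; linarith) hfx
    have hint0 := integral_symmIndicator_mul_singKernel_eq_zero hs0 hEm (hH x hfr) hint
    have hfar := integrable_farKernel (n := n) ha1 hr0
    have hif := integrable_symmIndicator_mul hEm x hfar
    have e1 : (fun z => symmIndicator E x z * nearKernel a r z) =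
        fun z => symmIndicator E x z * singKernel a z - symmIndicator E x z * farKernel a r z := by
      funext z; rw [nearKernel]; ring
    refine ⟨hb, ?_, ?_⟩
    · rw [e1]; exact hint.sub hif
    · rw [e1, integral_sub hint hif,
        integral_symmIndicator_mul hEm x hfar (farKernel_neg a r)]
      have hint0' : ∫ z, symmIndicator E x z * singKernel a z = 0 := hint0
      rw [hint0']; ring
  obtain ⟨-, hPint, hPzero⟩ := hzero P hPp hfP
  obtain ⟨hqb, -, hqzero⟩ := hzero q hqp hfQ
  -- the shear
  set φ := dropForm i (2 * κ) (Q - p) with hφ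
  have hφv : φ v = 0 := by
    rw [hφ, hv]
    show 2 * κ * dropInner i (Q - p) _ = 0
    rw [dropInner_single_right, mul_zero]
  have hφn : ∀ z, |φ z| ≤ κ * (n * R) / 4 * ‖z‖ := by
    intro z
    show |2 * κ * dropInner i (Q - p) z| ≤ _
    rw [abs_mul, abs_of_nonneg (by positivity : 0 ≤ 2 * κ)]
    have h1 := abs_dropInner_le_norm (i := i) (Q - p) z
    calc 2 * κ * |dropInner i (Q - p) z| ≤ 2 * κ * (n * (R / 8 * ‖z‖)) := by
          gcongr
          exact h1.trans (by gcongr)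
      _ = κ * (n * R) / 4 * ‖z‖ := by ring
  -- The increment of the paraboloid from `Q` has linear part `2 κ * dropInner i (Q - p) z`, which
  -- is `φ z`. The shear cancels it, leaving only `κ * dropInner i z z`.
  set T := LinearMap.transvection φ v with hT
  have hTz : ∀ z, T z = z + φ z • v := fun z => rfl
  have hTmp : MeasurePreserving T := measurePreserving_transvection hφv
  have hTemb : MeasurableEmbedding T :=
    (LinearEquiv.transvection hφv).toContinuousLinearEquiv.toHomeomorph.measurableEmbedding
  have hφT : ∀ z, φ (T z) = φ z := by
    intro z
    rw [hTz, map_add, map_smul, hφv, smul_zero, add_zero]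
  have hTε : ∀ z, ‖z - T z‖ ≤ (κ * (n * R) / 2) * ‖T z‖ := by
    intro z
    rw [hTz, sub_add_cancel_left, norm_neg, hnv, ← hTz, ← hφT]
    refine (hφn (T z)).trans ?_
    gcongr
    norm_num
  obtain ⟨hTint, hTdiff⟩ := abs_integral_symmIndicator_comp_sub_le (r := r) ha0 ha1 hr0 hEm hMS hqb
    hCp hpow (show 0 ≤ κ * (n * R) / 2 by positivity) (by linarith) hTmp hTemb hTε
  have hnear := h.le_integral_symmIndicator_shear (q := q) (P := P) hθ hv ha0 hML hlayer hκ0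
    (by linarith) (fun z => map_neg T z) hTint hPint (fun z hz hqz => by
      have hTzn : ‖T z‖ ≤ 2 * r := by
        have h1 := hφn z
        rw [hTz]
        refine (norm_add_le _ _).trans ?_
        rw [hnv]
        have h2 : κ * (n * R) / 4 * ‖z‖ ≤ 1 * ‖z‖ := by gcongr; linarith
        linarith
      have hmemD : Q + T z ∈ Metric.closedBall p (R / 2) := by
        have e1 : Q + T z - p = (Q - p) + T z := by abel
        rw [mem_closedBall_iff_norm, e1]
        linarith [norm_add_le (Q - p) (T z)]
      have e2 : q + T z = Q + T z + t • e := by rw [hq]; abel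
      have hmemR : Q + T z + t • e ∈ Metric.closedBall p R := by
        have e1 : Q + T z + t • e - p = (q - p) + T z := by rw [hq]; abel
        rw [mem_closedBall_iff_norm, e1]
        linarith [norm_add_le (q - p) (T z)]
      rw [e2] at hqz
      have hle : f (Q + T z + t • e) ≤ 0 := by
        by_contra! hpos
        exact h.notMem_of_pos _ hmemR hpos hqz
      have h1 := htouch' _ hmemD hle
      have e3 : dropInner i (T z) (T z) = dropInner i z z := by
        rw [hTz, dropInner_add_self, hv, smul_smul, dropInner_single_right, dropInner_single_right]
        ring
      have e4 : dropInner i (Q + T z - p) (Q + T z - p) =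
          dropInner i (Q - p) (Q - p) + 2 * dropInner i (Q - p) z + dropInner i z z := by
        have e5 : Q + T z - p = (Q - p) + T z := by abel
        have e6 : dropInner i (Q - p) (T z) = dropInner i (Q - p) z := by
          rw [hTz, dropInner_add_right, hv, smul_smul, dropInner_single_right, add_zero]
        rw [e5, dropInner_add_self, e3, e6]
      have e7 : Q + T z + (τ - κ * (dropInner i (Q + T z - p) (Q + T z - p) -
          dropInner i (Q - p) (Q - p))) • v = P + z - (κ * dropInner i z z) • v := by
        have e8 : τ - κ * (dropInner i (Q + T z - p) (Q + T z - p) -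
            dropInner i (Q - p) (Q - p)) = τ - φ z - κ * dropInner i z z := by
          have e9 : φ z = 2 * κ * dropInner i (Q - p) z := rfl
          rw [e4, e9]; ring
        rw [e8, hTz, hP, sub_smul (τ - φ z) _ v, sub_smul τ _ v]
        abel
      rwa [e7] at h1)
  have hτn : ‖τ • v‖ = τ := by rw [hnv, abs_of_nonneg hτ0]
  have hshift := abs_integral_signedIndicator_translate_sub_le ha1 hr0 hEm q (τ • v) hpow
    (by rw [hτn]; exact hτr)
  -- The point `P + t e` links the two far integrals: it differs from `q` by the small shift `τ v`,
  -- and from `P` by the translation that produces the gain.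
  have hPq : q + τ • v = P + t • e := by rw [hq, hP]; abel
  rw [hPq, hτn] at hshift
  have hgain := le_integral_signedIndicator_translate_sub (M := M) (d := R) ha0.le ha1 hr0 hEm P
    (t • e) p (hE t ht.le) (by linarith) (by linarith)
  rw [← hm] at hgain
  set V := volume.real ({x | x ∈ E ∧ x + t • e ∉ E} ∩ Metric.ball p M)
  have b1 := (abs_le.1 hTdiff).2
  have b2 := (abs_le.1 hshift).2
  -- At both `P` and `q`, the near integral equals minus twice the far one. Doubling the gain
  -- therefore bounds `4 m V` by the near integral at `P` minus that at `q`, plus the shift error.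
  have b3 : 4 * m * V ≤ 2 * Cp * (κ * (n * R) / 2) * MS + 4 * (κ * n * ML) +
      2 * (Cp * (τ / r) * K) := by linarith
  have b4 : 2 * Cp * (κ * (n * R) / 2) * MS + 4 * (κ * n * ML) + 2 * (Cp * (τ / r) * K) ≤
      (Cp * n * R * MS + 4 * n * ML + 2 * Cp / r * K) * (A * t ^ 2) := by
    have e1 : 2 * Cp * (κ * (n * R) / 2) * MS + 4 * (κ * n * ML) + 2 * (Cp * (τ / r) * K) =
        (Cp * n * R * MS + 4 * n * ML) * κ + 2 * Cp / r * K * τ := by ring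
    have e2 := mul_le_mul_of_nonneg_left hκA
      (by positivity : 0 ≤ Cp * n * R * MS + 4 * n * ML)
    have e3 := mul_le_mul_of_nonneg_left hτA (by positivity : 0 ≤ 2 * Cp / r * K)
    rw [e1, add_mul _ (2 * Cp / r * K)]
    exact add_le_add e2 e3
  rw [div_mul_eq_mul_div, le_div_iff₀ (by positivity)]
  linarith

/-! ### The linear lower bound -/

/-- For a set invariant under translations by `-t e`, which contains no half line in the direction
`e`, the volume of `E \ (E - t e)` in some ball is at least linear in `t`. -/
theorem exists_le_volume_diff {n : ℕ} {E : Set (EuclideanSpace ℝ (Fin (n + 1)))}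
    (hEm : NullMeasurableSet E) (hvol : volume E ≠ 0) (p e : EuclideanSpace ℝ (Fin (n + 1)))
    (he : ‖e‖ = 1) (hE : ∀ t : ℝ, 0 ≤ t → ∀ y, y + t • e ∈ E → y ∈ E)
    (hray : ∀ x, ∃ k : ℕ, x + (k : ℝ) • e ∉ E) :
    ∃ (M S b : ℝ), 0 < M ∧ 0 < S ∧ 0 < b ∧ ∀ L : ℕ, 0 < L →
      b ≤ L * volume.real ({x | x ∈ E ∧ x + (S / L) • e ∉ E} ∩ Metric.ball p M) := by
  have hshift : ∀ w : EuclideanSpace ℝ (Fin (n + 1)), NullMeasurableSet {x | x + w ∈ E} :=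
    fun w => hEm.preimage (measurePreserving_add_right volume w).quasiMeasurePreserving
  -- These sets exhaust `E` as `k` grows, by `hray`, so they cannot all be null.
  obtain ⟨k, hk⟩ : ∃ k : ℕ,
      volume ({x | x ∈ E ∧ x + (k : ℝ) • e ∉ E} ∩ Metric.ball p k) ≠ 0 := by
    by_contra! hcon
    refine hvol (measure_mono_null (fun x hx => ?_) (measure_iUnion_null hcon))
    obtain ⟨k₁, hk₁⟩ := hray x
    obtain ⟨k₂, hk₂⟩ := exists_nat_gt (dist x p)
    refine mem_iUnion.2 ⟨max k₁ k₂, ⟨hx, fun hmem => hk₁ ?_⟩, ?_⟩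
    · refine hE ((max k₁ k₂ : ℕ) - k₁ : ℝ) (by simp) _ ?_
      rwa [add_assoc, ← add_smul, add_sub_cancel]
    · exact hk₂.trans_le (by exact_mod_cast le_max_right _ _)
  have hk0 : 0 < k := by
    rcases Nat.eq_zero_or_pos k with rfl | h0
    · simp at hk
    · exact h0
  have hkR : (0 : ℝ) < k := by exact_mod_cast hk0
  -- The radius is doubled because points of the ball of radius `k` travel a distance of at most
  -- `k`.
  refine ⟨2 * k, k, volume.real ({x | x ∈ E ∧ x + (k : ℝ) • e ∉ E} ∩ Metric.ball p k),
    by positivity, hkR, ?_, fun L hL => ?_⟩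
  · exact ENNReal.toReal_pos hk
      ((measure_mono inter_subset_right).trans_lt measure_ball_lt_top).ne
  have hLR : (0 : ℝ) < L := by exact_mod_cast hL
  set t := (k : ℝ) / L with ht
  have ht0 : 0 < t := by positivity
  set A := {x | x ∈ E ∧ x + t • e ∉ E} ∩ Metric.ball p (2 * k) with hA
  have hAm : NullMeasurableSet A :=
    (hEm.inter (hshift _).compl).inter Metric.isOpen_ball.measurableSet.nullMeasurableSet
  have hAfin : volume A ≠ ∞ := ((measure_mono inter_subset_right).trans_lt measure_ball_lt_top).ne
  -- Along the `L` steps from `x` to `x + k e` there is a first exit from `E`; the position just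
  -- before it lies in `A`. All `L` preimages of `A` have the same volume.
  have hcover : {x | x ∈ E ∧ x + (k : ℝ) • e ∉ E} ∩ Metric.ball p k ⊆
      ⋃ j ∈ Finset.range L, (fun x => x + ((j : ℝ) * t) • e) ⁻¹' A := by
    rintro x ⟨⟨hx1, hx2⟩, hx3⟩
    have hex : ∃ j : ℕ, x + ((j : ℝ) * t) • e ∉ E := by
      refine ⟨L, ?_⟩
      rwa [ht, mul_div_cancel₀ _ hLR.ne']
    classical
    set j := Nat.find hex with hj
    have hj1 : x + ((j : ℝ) * t) • e ∉ E := Nat.find_spec hex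
    have hjL : j ≤ L := Nat.find_min' hex (by rwa [ht, mul_div_cancel₀ _ hLR.ne'])
    have hj0 : j ≠ 0 := by
      intro h0
      rw [h0] at hj1
      simp at hj1
      exact hj1 hx1
    obtain ⟨l, hl⟩ := Nat.exists_eq_succ_of_ne_zero hj0
    have hl1 : x + ((l : ℝ) * t) • e ∈ E := by
      by_contra hcon
      have := Nat.find_min' hex hcon
      omega
    refine mem_biUnion (Finset.mem_coe.2 (Finset.mem_range.2 (by omega : l < L))) ?_
    refine ⟨⟨hl1, ?_⟩, ?_⟩
    · rw [hl] at hj1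
      have e1 : x + ((l : ℝ) * t) • e + t • e = x + (((l.succ : ℕ) : ℝ) * t) • e := by
        rw [add_assoc, ← add_smul]
        congr 2
        push_cast; ring
      rw [e1]; exact hj1
    · have h1 : (l : ℝ) * t ≤ k := by
        have : (l : ℝ) ≤ L := by exact_mod_cast (by omega : l ≤ L)
        calc (l : ℝ) * t ≤ L * t := by gcongr
          _ = k := by rw [ht]; field_simp
      have e1 : x + ((l : ℝ) * t) • e - p = (x - p) + ((l : ℝ) * t) • e := by abel
      rw [mem_ball_iff_norm] at hx3 ⊢
      rw [e1]
      refine (norm_add_le _ _).trans_lt ?_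
      rw [norm_smul, he, mul_one, Real.norm_of_nonneg (by positivity)]
      linarith
  have hle : volume ({x | x ∈ E ∧ x + (k : ℝ) • e ∉ E} ∩ Metric.ball p k) ≤ L * volume A := by
    refine (measure_mono hcover).trans ((measure_biUnion_finset_le _ _).trans ?_)
    refine (Finset.sum_le_card_nsmul _ _ (volume A) fun j _ => ?_).trans ?_
    · exact ((measurePreserving_add_right volume _).measure_preimage hAm).le
    · simp
  have := ENNReal.toReal_mono (ENNReal.mul_ne_top (ENNReal.natCast_ne_top L) hAfin) hle
  rwa [ENNReal.toReal_mul, ENNReal.toReal_natCast] at this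

end

/-! ### Conclusion -/

theorem theoremC3 (n : ℕ) (s : ℝ) (hs0 : 0 < s) (hs1 : s < 1 / 2)
    (γ : EuclideanSpace ℝ (Fin n) → ℝ)
    (hC2 : HasC2Boundary (graphRegion γ))
    (hH : ∀ x ∈ frontier (graphRegion γ), HasNonlocalMeanCurvature s (graphRegion γ) x 0) :
    ∀ x ∈ frontier (graphRegion γ), ∀ ν : EuclideanSpace ℝ (Fin (n + 1)),
      IsExteriorNormal (graphRegion γ) x ν → ν (Fin.last n) ≠ 0 := by
  rintro p - ν ⟨f, hf, rfl⟩ hν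
  set E := graphRegion γ with hEdef
  have hlast : gradient f p (Fin.last n) = 0 := by
    simpa [hf.gradient_ne_zero] using hν
  obtain ⟨i, hi⟩ : ∃ i, gradient f p i ≠ 0 := by
    by_contra! hcon
    exact hf.gradient_ne_zero (PiLp.ext hcon)
  -- On the line the last component of the gradient is the only one, so it cannot vanish.
  have hn : 0 < n := by
    rcases Nat.eq_zero_or_pos n with rfl | h0
    · exact absurd (by rwa [Fin.fin_one_eq_zero i]) hi
    · exact h0
  obtain ⟨θ, hθ, hpos⟩ := exists_sign_fderiv_pos hi
  obtain ⟨R, c, C, hch⟩ := hf.exists_isLocalChart (norm_smul_single hθ) hpos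
  set e : EuclideanSpace ℝ (Fin (n + 1)) := EuclideanSpace.single (Fin.last n) (1 : ℝ) with he
  have hen : ‖e‖ = 1 := by simp [he]
  have hGe : fderiv ℝ f p e = 0 := by
    rw [he, fderiv_single_eq_gradient, hlast]
  have hEm : NullMeasurableSet E := hC2.nullMeasurableSet
  have hadd : ∀ (x : EuclideanSpace ℝ (Fin (n + 1))) (t : ℝ),
      x + t • e ∈ E ↔ x (Fin.last n) + t < γ (horizontalPart x) := by
    intro x t
    have h1 : horizontalPart (x + t • e) = horizontalPart x := by
      ext j
      simp [horizontalPart, he, Fin.castSucc_ne_last]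
    show (x + t • e) (Fin.last n) < γ (horizontalPart (x + t • e)) ↔ _
    rw [h1]
    simp [he]
  have hE : ∀ t : ℝ, 0 ≤ t → ∀ y, y + t • e ∈ E → y ∈ E := by
    intro t ht y hy
    have h1 := (hadd y t).1 hy
    show y (Fin.last n) < γ (horizontalPart y)
    linarith
  have hray : ∀ x, ∃ k : ℕ, x + (k : ℝ) • e ∉ E := by
    intro x
    obtain ⟨k, hk⟩ := exists_nat_ge (γ (horizontalPart x) - x (Fin.last n))
    refine ⟨k, fun h => ?_⟩
    have := (hadd x k).1 h
    linarith
  have hvol : volume E ≠ 0 := by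
    intro h0
    have hempty : interior E = ∅ :=
      (isOpen_interior.measure_eq_zero_iff volume).1 (measure_mono_null interior_subset h0)
    obtain ⟨x, hx⟩ := hch.nonempty_interior hf.eq_zero
    simp [hempty] at hx
  obtain ⟨M, S, b, hM, hS, hb, hlow⟩ := exists_le_volume_diff hEm hvol p e hen hE hray
  obtain ⟨t₀, B, ht₀, hup⟩ := hch.exists_volume_diff_le hn hs0 hs1 hEm hH hθ rfl hf.eq_zero hen hGe
    hE hM
  -- The first bound makes `S / L` admissible in the upper estimate; the second makes `L * B (S /
  -- L)²` smaller than `b`.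
  obtain ⟨L, hL⟩ := exists_nat_gt (max (S / t₀) (B * S ^ 2 / b))
  have hL1 : S / t₀ < L := (le_max_left _ _).trans_lt hL
  have hL2 : B * S ^ 2 / b < L := (le_max_right _ _).trans_lt hL
  have hL0 : (0 : ℝ) < L := lt_trans (by positivity) hL1
  have h1 := hlow L (by exact_mod_cast hL0)
  have h2 := hup (S / L) (by positivity) (by
    rw [div_lt_iff₀ ht₀] at hL1
    rw [div_le_iff₀ hL0]; linarith)
  rw [div_lt_iff₀ hb] at hL2
  have h3 : b ≤ L * (B * (S / L) ^ 2) := h1.trans (by gcongr)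
  have h4 : L * (B * (S / L) ^ 2) = B * S ^ 2 / L := by field_simp
  rw [h4, le_div_iff₀ hL0] at h3
  linarith
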